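/- Let $(W,S)$ be a Coxeter system with finite ordered generating set $S=\{s_1<\dots<s_N\}$ and Coxeter matrix $(m(s,t))$, with length function $l$, and let $A$ be its Artin group, generated by elements $g_s$ $(s\in S)$ with the braid relations $g_sg_tg_s\cdots=g_tg_sg_t\cdots$ ($m(s,t)$ factors on each side) for $m(s,t)<\infty$. Let $\psi:W\to A$ send $w=s_{i_1}\cdots s_{i_l}$ (any reduced word) to $g_{s_{i_1}}\cdots g_{s_{i_l}}$. Let $M$ be a $\mathbb Z$-module and $\lambda:A\to\mathrm{Aut}(M)$ a representation. For $T\subset S$ let $W_T$ be the subgroup generated by $T$. The algebraic Salvetti complex $(\mathcal C^*,\delta)$ is $$\mathcal C^n=\bigoplus_{|T|=n,\ |W_T|<\infty}M.e_T,\qquad \delta(a.e_T)=\sum_{s\in S\setminus T,\ |W_{T\cup\{s\}}|<\infty}(-1)^{\sigma(s,T)+1}\sum_{w}(-1)^{l(w)}\lambda(\psi(w))(a).e_{T\cup\{s\}},$$ where $w$ runs over the minimal length representatives of the cosets in $W_{T\cup\{s\}}/W_T$ and $\sigma(s,T)$ is the number of elements of $T$ strictly smaller than $s$. Let $\mathcal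 F^k\mathcal C^*=\langle e_T\mid s_{N-k+1},\dots,s_N\in T\rangle$ for $0\le k\le N$, $\mathcal F^k\mathcal C^*=\mathcal C^*$ for $k\le 0$ and $\mathcal F^k\mathcal C^*=0$ for $k>N$. Then $(\mathcal C^*,\delta)$ is a cochain complex, the $\mathcal F^k\mathcal C^*$ form a decreasing filtration of it by subcomplexes, and the spectral sequence $(E_r,d_r)_{r\ge0}$ of this filtered complex, with $$E_r^{i,j}=\bigl(Z_r^i/(Z_{r-1}^{i+1}+\delta Z_{r-1}^{i-r+1})\bigr)^{i+j},\qquad Z_r^i=\{c\in\mathcal F^i\mathcal C^*\mid\delta c\in\mathcal F^{i+r}\mathcal C^*\},$$ and $d_r:E_r^{i,j}\to E_r^{i+r,j-r+1}$ induced by $\delta$, has the following properties. (1) It is a first-quadrant spectral sequence: $E_r^{i,j}=0$ unless $i\ge0$ and $j\ge0$. (2) $E_0^{i,j}=\mathcal F^i\mathcal C^{i+j}/\mathcal F^{i+1}\mathcal C^{i+j}$, and $d_0$ is the map induced by $\delta$ on the quotient complex $\mathcal F^i\mathcal C^*/\mathcal F^{i+1}\mathcal C^*$. (3) $E_1^{i,j}=H^{i+j}(\mathcal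 F^i\mathcal C^*/\mathcal F^{i+1}\mathcal C^*)$, the identification being induced by that of $E_0$, and $d_1:E_1^{i,j}\to E_1^{i+1,j}$ is the boundary operator of the triple $(\mathcal F^{i+2}\mathcal C^*,\mathcal F^{i+1}\mathcal C^*,\mathcal F^i\mathcal C^*)$, that is, the connecting homomorphism of the short exact sequence $0\to\mathcal F^{i+1}\mathcal C^*/\mathcal F^{i+2}\mathcal C^*\to\mathcal F^i\mathcal C^*/\mathcal F^{i+2}\mathcal C^*\to\mathcal F^i\mathcal C^*/\mathcal F^{i+1}\mathcal C^*\to0$. (4) It converges to $H^{i+j}(\mathcal C^*)$: with $F^iH^n=\mathrm{im}\bigl(H^n(\mathcal F^i\mathcal C^*)\to H^n(\mathcal C^*)\bigr)$ one has $F^0H^n=H^n(\mathcal C^*)$, $F^{n+1}H^n=0$, and for each $(i,j)$ and all sufficiently large $r$ the differentials $d_r$ from and to $E_r^{i,j}$ vanish and $E_r^{i,j}\cong F^iH^{i+j}/F^{i+1}H^{i+j}$, the class of a cocycle in $\mathcal F^i\mathcal C^{i+j}$ corresponding to the class of its cohomology class. -/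

import Mathlib

open CategoryTheory

universe u v w

/-! ### Filtered cochain complexes and their spectral sequences -/

/-- A decreasing filtration `… ⊇ F^k K ⊇ F^{k+1} K ⊇ …` of a cochain complex of modules
by subcomplexes. -/
structure ComplexFiltration {R : Type w} [Ring R] (K : CochainComplex (ModuleCat.{v} R) ℤ) where
  /-- `F k n` is the submodule `F^k K^n` of `K^n` -/
  F (k n : ℤ) : Submodule R (K.X n)
  anti (n : ℤ) {k l : ℤ} (h : k ≤ l) : F l n ≤ F k n
  d_mem (k n m : ℤ) {x : K.X n} (hx : x ∈ F k n) : (K.d n m).hom x ∈ F k m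

namespace ComplexFiltration

variable {R : Type w} [Ring R] {K : CochainComplex (ModuleCat.{v} R) ℤ} (𝓕 : ComplexFiltration K)

/-- The subcomplex `F^k K`. -/
def sub (k : ℤ) : CochainComplex (ModuleCat.{v} R) ℤ where
  X n := ModuleCat.of R (𝓕.F k n)
  d n m := ModuleCat.ofHom ((K.d n m).hom.restrict fun _ hx => 𝓕.d_mem k n m hx)
  shape n m h := by
    refine ModuleCat.hom_ext (LinearMap.ext fun x => Subtype.ext ?_)
    change (K.d n m).hom x.1 = 0
    rw [K.shape n m h]
    rfl
  d_comp_d' n m p _ _ := by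
    refine ModuleCat.hom_ext (LinearMap.ext fun x => Subtype.ext ?_)
    exact LinearMap.congr_fun (congrArg ModuleCat.Hom.hom (K.d_comp_d n m p)) x.1

/-- The inclusion of the subcomplex `F^k K` into `K`. -/
def incl (k : ℤ) : 𝓕.sub k ⟶ K where
  f n := ModuleCat.ofHom (𝓕.F k n).subtype
  comm' n m _ := by
    ext x
    rfl

/-- The quotient complex `F^a K / F^b K` (meant for `a ≤ b`). -/
def quot (a b : ℤ) : CochainComplex (ModuleCat.{v} R) ℤ where
  X n := ModuleCat.of R (𝓕.F a n ⧸ (𝓕.F b n).submoduleOf (𝓕.F a n))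
  d n m := ModuleCat.ofHom
    (((𝓕.F b n).submoduleOf (𝓕.F a n)).mapQ ((𝓕.F b m).submoduleOf (𝓕.F a m))
      ((K.d n m).hom.restrict fun _ hx => 𝓕.d_mem a n m hx)
      fun _ hx => 𝓕.d_mem b n m hx)
  shape n m h := by
    apply ModuleCat.hom_ext
    apply Submodule.linearMap_qext
    refine LinearMap.ext fun x => congrArg Submodule.Quotient.mk (Subtype.ext ?_)
    change (K.d n m).hom x.1 = 0
    rw [K.shape n m h]
    rfl
  d_comp_d' n m p _ _ := by
    apply ModuleCat.hom_ext
    apply Submodule.linearMap_qext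
    refine LinearMap.ext fun x => congrArg Submodule.Quotient.mk (Subtype.ext ?_)
    exact LinearMap.congr_fun (congrArg ModuleCat.Hom.hom (K.d_comp_d n m p)) x.1

/-- The class in `F^a K^n / F^b K^n` of an element of `F^a K^n`. -/
def toQuot (a b n : ℤ) : 𝓕.F a n →ₗ[R] (𝓕.quot a b).X n :=
  ((𝓕.F b n).submoduleOf (𝓕.F a n)).mkQ

/-- The map of complexes `F^a K / F^b K ⟶ F^{a'} K / F^{b'} K` induced by the inclusions,
for `a' ≤ a` and `b' ≤ b`. -/
def quotMap {a b a' b' : ℤ} (ha : a' ≤ a) (hb : b' ≤ b) : 𝓕.quot a b ⟶ 𝓕.quot a' b' where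
  f n := ModuleCat.ofHom
    (((𝓕.F b n).submoduleOf (𝓕.F a n)).mapQ ((𝓕.F b' n).submoduleOf (𝓕.F a' n))
      (Submodule.inclusion (𝓕.anti n ha)) fun _ hx => 𝓕.anti n hb hx)
  comm' n m _ := by
    apply ModuleCat.hom_ext
    apply Submodule.linearMap_qext
    ext x
    rfl

/-- The sequence `0 → F^{i+1}K/F^{i+2}K → F^iK/F^{i+2}K → F^iK/F^{i+1}K → 0` of the triple
`(F^{i+2}K, F^{i+1}K, F^iK)`. -/
def triple (i : ℤ) : ShortComplex (CochainComplex (ModuleCat.{v} R) ℤ) where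
  X₁ := 𝓕.quot (i + 1) (i + 1 + 1)
  X₂ := 𝓕.quot i (i + 1 + 1)
  X₃ := 𝓕.quot i (i + 1)
  f := 𝓕.quotMap (by lia) le_rfl
  g := 𝓕.quotMap le_rfl (by lia)
  zero := by
    ext n : 1
    apply ModuleCat.hom_ext
    apply Submodule.linearMap_qext
    ext x
    exact (Submodule.Quotient.mk_eq_zero _).2 x.2

/-- The filtration `F^i H^n(K) = im (H^n(F^i K) → H^n(K))` induced on cohomology. -/
noncomputable def onCohomology (i n : ℤ) : Submodule R (K.homology n) :=
  LinearMap.range (HomologicalComplex.homologyMap (𝓕.incl i) n).hom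

/-- `Z_r^i` in degree `n`: the cochains `c ∈ F^i K^n` with `d c ∈ F^{i+r} K^{n+1}`. -/
def Z (r i n : ℤ) : Submodule R (K.X n) :=
  𝓕.F i n ⊓ (𝓕.F (i + r) (n + 1)).comap (K.d n (n + 1)).hom

/-- `Z_{r-1}^{i+1} + d Z_{r-1}^{i-r+1}` in degree `n`. -/
def B (r i n : ℤ) : Submodule R (K.X n) :=
  𝓕.Z (r - 1) (i + 1) n ⊔ (𝓕.Z (r - 1) (i - r + 1) (n - 1)).map (K.d (n - 1) n).hom

/-- The spectral sequence of a filtered complex, starting from the page `E_0`: a cohomological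
spectral sequence (`d_r` has bidegree `(r, 1 - r)`) such that `E_r^{i,j}` is
`Z_r^i / (Z_{r-1}^{i+1} + d Z_{r-1}^{i-r+1})` in degree `i + j`, the differential `d_r` is induced
by `d`, and the isomorphism of `H(E_r)` with `E_{r+1}` is the identity on representatives. -/
structure AssociatedSpectralSequence where
  /-- the underlying spectral sequence -/
  E : CohomologicalSpectralSequence (ModuleCat.{v} R) 0
  /-- the class in `E_r^{i,j}` of an element of `Z_r^i` of degree `i + j` -/
  cls (r : ℤ) (hr : 0 ≤ r) (i j : ℤ) : 𝓕.Z r i (i + j) →ₗ[R] (E.page r hr).X (i, j)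
  cls_surjective (r : ℤ) (hr : 0 ≤ r) (i j : ℤ) : Function.Surjective (cls r hr i j)
  cls_eq_zero_iff (r : ℤ) (hr : 0 ≤ r) (i j : ℤ) (x : 𝓕.Z r i (i + j)) :
    cls r hr i j x = 0 ↔ x.1 ∈ 𝓕.B r i (i + j)
  d_cls (r : ℤ) (hr : 0 ≤ r) (i j i' j' : ℤ) (hi : i + r = i') (hj : j + (1 - r) = j')
    (x : 𝓕.Z r i (i + j)) (y : 𝓕.Z r i' (i' + j'))
    (hxy : (K.d (i + j) (i' + j')).hom x.1 = y.1) :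
    ((E.page r hr).d (i, j) (i', j')).hom (cls r hr i j x) = cls r hr i' j' y
  iso_cls (r : ℤ) (hr : 0 ≤ r) (i j : ℤ) (x : 𝓕.Z r i (i + j)) (y : 𝓕.Z (r + 1) i (i + j))
    (hxy : x.1 = y.1) (z : (E.page r hr).cycles (i, j))
    (hz : ((E.page r hr).iCycles (i, j)).hom z = cls r hr i j x) :
    (E.iso r (r + 1) (i, j) rfl hr).hom.hom (((E.page r hr).homologyπ (i, j)).hom z) =
      cls (r + 1) (by lia) i j y

namespace AssociatedSpectralSequence

variable {𝓕} (S : 𝓕.AssociatedSpectralSequence)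

/-- `E_r^{i,j} = 0` for all `r` unless `i ≥ 0` and `j ≥ 0`. -/
def IsFirstQuadrant : Prop :=
  ∀ (r : ℤ) (hr : 0 ≤ r) (i j : ℤ), i < 0 ∨ j < 0 → Limits.IsZero ((S.E.page r hr).X (i, j))

/-- Convergence of `E_0^{i,j}` to `H^{i+j}(K)`: the induced filtration of each `H^n(K)` is finite,
and for every `(i, j)` there is a page from which on all differentials from and to the position
`(i, j)` vanish and `E_r^{i,j}` is the graded piece `F^i H^{i+j}(K) / F^{i+1} H^{i+j}(K)`, the
isomorphism sending the class of a cocycle of `F^i K` to the class of its cohomology class. -/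
def Converges : Prop :=
  (∀ n : ℤ, (∃ a : ℤ, 𝓕.onCohomology a n = ⊤) ∧ ∃ b : ℤ, 𝓕.onCohomology b n = ⊥) ∧
  ∀ i j : ℤ, ∃ r₀ : ℤ, ∀ (r : ℤ) (hr : 0 ≤ r), r₀ ≤ r →
    (∀ p : ℤ × ℤ, (S.E.page r hr).d (i, j) p = 0 ∧ (S.E.page r hr).d p (i, j) = 0) ∧
    ∃ e : (S.E.page r hr).X (i, j) ≃ₗ[R]
        (𝓕.onCohomology i (i + j) ⧸
          (𝓕.onCohomology (i + 1) (i + j)).submoduleOf (𝓕.onCohomology i (i + j))),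
      ∀ (x : 𝓕.Z r i (i + j)) (z : K.cycles (i + j)), (K.iCycles (i + j)).hom z = x.1 →
        ∃ h : (K.homologyπ (i + j)).hom z ∈ 𝓕.onCohomology i (i + j),
          e (S.cls r hr i j x) = Submodule.Quotient.mk ⟨(K.homologyπ (i + j)).hom z, h⟩

end AssociatedSpectralSequence

end ComplexFiltration

/-! ### Artin groups and the algebraic Salvetti complex -/

/-- The Artin group of a Coxeter matrix: one generator `g_s` for each vertex and one relation
`g_s g_t g_s ⋯ = g_t g_s g_t ⋯` (`m(s,t)` factors on each side) for each pair of vertices with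
`m(s,t) < ∞`. (In a `CoxeterMatrix`, `m(s,t) = ∞` is encoded by the value `0`, for which both words
are empty.) -/
abbrev ArtinGroup {B : Type*} (Γ : CoxeterMatrix B) : Type _ :=
  PresentedGroup (Set.range fun p : B × B =>
    ((CoxeterSystem.alternatingWord p.1 p.2 (Γ p.1 p.2)).map FreeGroup.of).prod *
      (((CoxeterSystem.alternatingWord p.2 p.1 (Γ p.1 p.2)).map FreeGroup.of).prod)⁻¹)

namespace Salvetti

variable {N : ℕ} {Γ : CoxeterMatrix (Fin N)} {W : Type u} [Group W] (cs : CoxeterSystem Γ W)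

/-- The standard parabolic subgroup `W_T` generated by `T ⊆ S`. -/
def parabolic (T : Finset (Fin N)) : Subgroup W :=
  Subgroup.closure (cs.simple '' (T : Set (Fin N)))

/-- The section `ψ : W → A_Γ`: write `w` as a reduced word and read this word in the Artin group.
(By Matsumoto's theorem the result does not depend on the reduced word.) -/
noncomputable def lift (w : W) : ArtinGroup Γ :=
  ((cs.exists_isReduced w).choose.map fun s => (PresentedGroup.of s : ArtinGroup Γ)).prod

/-- The set of the minimal length representatives of the cosets in `W_U / W_T`, `T ⊆ U`. -/
def minReps (U T : Finset (Fin N)) : Set W :=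
  {w | w ∈ parabolic cs U ∧ ∀ v ∈ parabolic cs T, cs.length w ≤ cs.length (w * v)}

/-- The `n`-cells: subsets `T ⊆ S` with `|T| = n` and `W_T` finite. -/
abbrev Cell (n : ℤ) : Type :=
  {T : Finset (Fin N) // (T.card : ℤ) = n ∧ Finite (parabolic cs T)}

variable {R : Type w} [CommRing R] {M : Type v} [AddCommGroup M] [Module R M]
  (ρ : ArtinGroup Γ →* (M ≃ₗ[R] M))

/-- `C^n = ⨁ M.e_T`, the sum being over the subsets `T` with `|T| = n` and `W_T` finite. -/
abbrev Cochain (_ρ : ArtinGroup Γ →* (M ≃ₗ[R] M)) (n : ℤ) : Type v := Cell cs n →₀ M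

/-- The endomorphism `∑ (-1)^{l(w)} ρ(ψ(w))` of `M`, summed over the minimal length representatives
of the cosets in `W_U / W_T`. -/
noncomputable def cosetSum (U T : Finset (Fin N)) : M →ₗ[R] M :=
  ∑ᶠ w ∈ minReps cs U T, (-1 : ℤ) ^ cs.length w • (ρ (lift cs w)).toLinearMap

/-- The number of elements of `T` that are strictly smaller than `s`. -/
def sigma (s : Fin N) (T : Finset (Fin N)) : ℕ := (T.filter (· < s)).card

open Classical in
/-- The coboundary
`δ(a.e_T) = ∑_s (-1)^{σ(s,T)+1} (∑_w (-1)^{l(w)} ρ(ψ(w)) a).e_{T ∪ {s}}`, where `s` runs over the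
elements of `S \ T` such that `W_{T ∪ {s}}` is finite. -/
noncomputable def delta (n : ℤ) : Cochain cs ρ n →ₗ[R] Cochain cs ρ (n + 1) :=
  Finsupp.lsum R fun T : Cell cs n =>
    ∑ s : Fin N,
      if h : s ∉ T.1 ∧ Finite (parabolic cs (insert s T.1)) then
        (-1 : ℤ) ^ (sigma s T.1 + 1) •
          (Finsupp.lsingle
            (⟨insert s T.1, by rw [Finset.card_insert_of_notMem h.1]; push_cast; rw [T.2.1], h.2⟩ :
              Cell cs (n + 1)) ∘ₗ cosetSum cs ρ (insert s T.1) T.1)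
      else 0

/-- The complex `(C^*, δ)`, once `δ ∘ δ = 0` is known. -/
noncomputable def complex (hδ : ∀ n, delta cs ρ (n + 1) ∘ₗ delta cs ρ n = 0) :
    CochainComplex (ModuleCat.{v} R) ℤ :=
  CochainComplex.of (fun n => ModuleCat.of R (Cochain cs ρ n))
    (fun n => ModuleCat.ofHom (delta cs ρ n))
    (fun n => ModuleCat.hom_ext (hδ n))

/-- `F^k C^n = ⟨e_T : s_{N-k+1}, …, s_N ∈ T⟩` for `k ≤ N`, and `F^k C^n = 0` for `k > N`.
The vertex `s_p` is `(p - 1 : Fin N)`, so the condition `p ≥ N - k + 1` on `p = t + 1` reads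
`N ≤ t + k`. -/
noncomputable def filtration (k n : ℤ) : Submodule R (Cochain cs ρ n) :=
  Finsupp.supported M R {T : Cell cs n | k ≤ N ∧ ∀ t : Fin N, (N : ℤ) ≤ (t : ℤ) + k → t ∈ T.1}

end Salvetti

/-! Two independent arguments meet here. The first is general. In a filtered complex everything
about the pages can be checked on representatives: a cycle of `E_r` can be corrected by an element
of `Z_{r-1}^{i+1}` until it lies in `Z_{r+1}^i`, and it is then a boundary exactly when it lies in
`B_{r+1}^i`, so `H(E_r) = E_{r+1}` (`pageCycle_surjective`, `homologyπ_pageCycle_eq_zero_iff`). If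
`F^a K = K` and `F^b K = 0`, then for large `r` the group `Z_r^i` consists of the cocycles of `F^i
K`, and two of them agree in `E_r` exactly when they are cohomologous up to a cocycle of `F^{i+1} K`
(`converges_of_bounded`).

The second argument is `δ² = 0`. For `T ⊆ T' ⊆ U` every minimal representative of `W_U / W_T` is
uniquely `x y` with `x`, `y` minimal for `W_U / W_{T'}` and `W_{T'} / W_T`, and the lengths add.
Since `ψ` is multiplicative on such products, the coset sums compose (`cosetSum_comp`). The two ways
from `T` to `T ∪ {s, t}` therefore carry the same operator, with opposite signs. That `ψ` does not
depend on reduced words is Matsumoto's theorem. It rests on the exchange property, obtained from an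
action of `W` on `W × ℤ/2`, and on the exact order of `s_i s_j`, read off from the geometric
representation.

Finally `F^k C^n = 0` for `k > n`, since `T` must contain `k` prescribed vertices. This gives the
first quadrant and `F^{n+1} H^n = 0`. -/

/-! ### Homology of complexes of modules -/

section Modules

variable {R : Type*} [Ring R] {Z H Q : Type*} [AddCommGroup Z] [AddCommGroup H] [AddCommGroup Q]
  [Module R Z] [Module R H] [Module R Q]

/-- The isomorphism between two quotients of `Z` by the same submodule. -/
noncomputable def LinearMap.equivOfKerEq (f : Z →ₗ[R] H) (g : Z →ₗ[R] Q)
    (hf : Function.Surjective f) (hg : Function.Surjective g)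
    (h : LinearMap.ker f = LinearMap.ker g) : H ≃ₗ[R] Q :=
  (f.quotKerEquivOfSurjective hf).symm ≪≫ₗ Submodule.quotEquivOfEq _ _ h ≪≫ₗ
    g.quotKerEquivOfSurjective hg

theorem LinearMap.equivOfKerEq_apply (f : Z →ₗ[R] H) (g : Z →ₗ[R] Q)
    (hf : Function.Surjective f) (hg : Function.Surjective g)
    (h : LinearMap.ker f = LinearMap.ker g) (x : Z) :
    LinearMap.equivOfKerEq f g hf hg h (f x) = g x := by
  have : (f.quotKerEquivOfSurjective hf).symm (f x) = Submodule.Quotient.mk x := by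
    rw [LinearEquiv.symm_apply_eq]
    rfl
  simp only [LinearMap.equivOfKerEq, LinearEquiv.trans_apply, this]
  rfl

end Modules

namespace HomologicalComplex

variable {R : Type w} [Ring R] {ι : Type*} {c : ComplexShape ι}
  (C : HomologicalComplex (ModuleCat.{v} R) c)

theorem iCycles_injective (i : ι) : Function.Injective (C.iCycles i).hom :=
  (ModuleCat.mono_iff_injective (C.iCycles i)).1 inferInstance

theorem homologyπ_surjective (i : ι) : Function.Surjective (C.homologyπ i).hom :=
  (ModuleCat.epi_iff_surjective (C.homologyπ i)).1 inferInstance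

theorem d_iCycles_apply (i j : ι) (z : C.cycles i) :
    (C.d i j).hom ((C.iCycles i).hom z) = 0 := by
  have := congrArg (fun f => f.hom z) (C.iCycles_d i j)
  exact this

/-- The map to the module of cycles induced by a linear map whose values are cycles. -/
noncomputable def liftCyclesLinear {Z : Type v} [AddCommGroup Z] [Module R Z] {i j : ι}
    (hij : c.next i = j) (f : Z →ₗ[R] C.X i) (hf : ∀ z, (C.d i j).hom (f z) = 0) :
    Z →ₗ[R] C.cycles i :=
  (C.liftCycles (A := ModuleCat.of R Z) (ModuleCat.ofHom f) j hij
    (ModuleCat.hom_ext (LinearMap.ext hf))).hom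

theorem iCycles_liftCyclesLinear {Z : Type v} [AddCommGroup Z] [Module R Z] {i j : ι}
    (hij : c.next i = j) (f : Z →ₗ[R] C.X i) (hf : ∀ z, (C.d i j).hom (f z) = 0) (z : Z) :
    (C.iCycles i).hom (C.liftCyclesLinear hij f hf z) = f z :=
  congrArg (fun g => g.hom z) (C.liftCycles_i (A := ModuleCat.of R Z) (ModuleCat.ofHom f) j hij
    (ModuleCat.hom_ext (LinearMap.ext hf)))

theorem homologyπ_eq_zero_iff {i j : ι} (hij : c.prev j = i) (z : C.cycles j) :
    (C.homologyπ j).hom z = 0 ↔ ∃ y, (C.d i j).hom y = (C.iCycles j).hom z := by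
  have hto : ∀ y, (C.iCycles j).hom ((C.toCycles i j).hom y) = (C.d i j).hom y := fun y =>
    congrArg (fun g => g.hom y) (C.toCycles_i i j)
  have hex : (ShortComplex.mk _ _ (C.toCycles_comp_homologyπ i j)).Exact :=
    ShortComplex.exact_of_g_is_cokernel _ (C.homologyIsCokernel i j hij)
  rw [ShortComplex.moduleCat_exact_iff] at hex
  constructor
  · intro h
    obtain ⟨y, hy⟩ := hex z h
    exact ⟨y, by rw [← hto]; exact congrArg _ hy⟩
  · rintro ⟨y, hy⟩
    have : (C.toCycles i j).hom y = z := C.iCycles_injective j (by rw [hto, hy])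
    rw [← this]
    exact congrArg (fun g => g.hom y) (C.toCycles_comp_homologyπ i j)

end HomologicalComplex

/-! ### Construction of the pages and of the isomorphisms `H(E_r) ≅ E_{r+1}`. -/

namespace ComplexFiltration

variable {R : Type w} [Ring R] {K : CochainComplex (ModuleCat.{v} R) ℤ} (𝓕 : ComplexFiltration K)

/-- Total degrees such as `i + r + (j + (1 - r))` and `i + j + 1` are equal only propositionally.
Free indices `m` and `k` avoid transport along such equations. -/
theorem mem_Z_iff {r i n m k : ℤ} (hm : n + 1 = m) (hk : i + r = k) (x : K.X n) :
    x ∈ 𝓕.Z r i n ↔ x ∈ 𝓕.F i n ∧ (K.d n m).hom x ∈ 𝓕.F k m := by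
  subst hm hk
  rfl

theorem mem_B_iff {r i n m k : ℤ} (hm : m + 1 = n) (hk : k + (r - 1) = i) (x : K.X n) :
    x ∈ 𝓕.B r i n ↔ ∃ y ∈ 𝓕.Z (r - 1) (i + 1) n, ∃ z ∈ 𝓕.Z (r - 1) k m,
      y + (K.d m n).hom z = x := by
  obtain rfl : m = n - 1 := by lia
  obtain rfl : k = i - r + 1 := by lia
  simp only [B, Submodule.mem_sup, Submodule.mem_map]
  constructor
  · rintro ⟨y, hy, _, ⟨z, hz, rfl⟩, h⟩
    exact ⟨y, hy, z, hz, h⟩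
  · rintro ⟨y, hy, z, hz, h⟩
    exact ⟨y, hy, _, ⟨z, hz, rfl⟩, h⟩

theorem d_d_apply (n m k : ℤ) (x : K.X n) : (K.d m k).hom ((K.d n m).hom x) = 0 :=
  congrArg (fun g => g.hom x) (K.d_comp_d n m k)

theorem d_mem_Z {r i n m k s : ℤ} (hm : n + 1 = m) (hk : i + r = k) {x : K.X n}
    (hx : x ∈ 𝓕.Z r i n) : (K.d n m).hom x ∈ 𝓕.Z s k m := by
  refine (𝓕.mem_Z_iff rfl rfl _).2 ⟨((𝓕.mem_Z_iff hm hk x).1 hx).2, ?_⟩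
  rw [d_d_apply]
  exact zero_mem _

theorem d_mem_B {r i n m k : ℤ} (hm : n + 1 = m) (hk : i + r = k) {x : K.X n}
    (hx : x ∈ 𝓕.B r i n) : (K.d n m).hom x ∈ 𝓕.B r k m := by
  obtain ⟨y, hy, z, -, rfl⟩ :=
    (𝓕.mem_B_iff (m := n - 1) (k := i - r + 1) (by lia) (by lia) x).1 hx
  refine (𝓕.mem_B_iff hm (k := i + 1) (by lia) _).2 ⟨0, zero_mem _, y, hy, ?_⟩
  rw [map_add, d_d_apply, zero_add, add_zero]

/-- The term of the spectral sequence on the page `r`, in filtration degree `i` and total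
degree `n`. -/
abbrev pageX (r i n : ℤ) : ModuleCat.{v} R :=
  ModuleCat.of R (𝓕.Z r i n ⧸ (𝓕.B r i n).submoduleOf (𝓕.Z r i n))

/-- The differential of the page `r`, as a map between modules of known total degree. -/
def pageD {r i n m k : ℤ} (hm : n + 1 = m) (hk : i + r = k) :
    𝓕.pageX r i n ⟶ 𝓕.pageX r k m :=
  ModuleCat.ofHom (Submodule.mapQ _ _
    ((K.d n m).hom.restrict fun _ hx => 𝓕.d_mem_Z hm hk hx)
    fun _ hx => 𝓕.d_mem_B hm hk hx)

/-- The page `E_r`. -/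
def page (r : ℤ) :
    HomologicalComplex (ModuleCat.{v} R) (ComplexShape.up' (⟨r, 1 - r⟩ : ℤ × ℤ)) where
  X p := 𝓕.pageX r p.1 (p.1 + p.2)
  d p q := if h : p + ⟨r, 1 - r⟩ = q then
      𝓕.pageD (by subst h; simp only [Prod.fst_add, Prod.snd_add]; ring) (congrArg Prod.fst h)
    else 0
  shape p q h := dif_neg h
  d_comp_d' p q s hpq hqs := by
    rw [dif_pos (show p + _ = q from hpq), dif_pos (show q + _ = s from hqs)]
    apply ModuleCat.hom_ext
    apply Submodule.linearMap_qext
    refine LinearMap.ext fun x => congrArg Submodule.Quotient.mk (Subtype.ext ?_)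
    exact d_d_apply _ _ _ x.1

/-- The class in `E_r^{i,j}` of an element of `Z_r^i`. -/
def pageCls (r i j : ℤ) : 𝓕.Z r i (i + j) →ₗ[R] (𝓕.page r).X (i, j) :=
  ((𝓕.B r i (i + j)).submoduleOf (𝓕.Z r i (i + j))).mkQ

theorem pageCls_surjective (r i j : ℤ) : Function.Surjective (𝓕.pageCls r i j) :=
  Submodule.mkQ_surjective _

theorem pageCls_eq_zero_iff (r i j : ℤ) (x : 𝓕.Z r i (i + j)) :
    𝓕.pageCls r i j x = 0 ↔ x.1 ∈ 𝓕.B r i (i + j) :=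
  Submodule.Quotient.mk_eq_zero _

theorem page_d_pageCls {r i j i' j' : ℤ} (hi : i + r = i') (hj : j + (1 - r) = j')
    (x : 𝓕.Z r i (i + j)) (y : 𝓕.Z r i' (i' + j'))
    (hxy : (K.d (i + j) (i' + j')).hom x.1 = y.1) :
    ((𝓕.page r).d (i, j) (i', j')).hom (𝓕.pageCls r i j x) = 𝓕.pageCls r i' j' y := by
  have h : ((i, j) : ℤ × ℤ) + ⟨r, 1 - r⟩ = (i', j') := by ext <;> simpa
  have hd : (𝓕.page r).d (i, j) (i', j') =
      𝓕.pageD (n := i + j) (m := i' + j') (by lia) hi := dif_pos h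
  rw [hd]
  exact congrArg Submodule.Quotient.mk (Subtype.ext hxy)

theorem Z_succ_le (r i n : ℤ) : 𝓕.Z (r + 1) i n ≤ 𝓕.Z r i n := fun x hx =>
  ⟨hx.1, 𝓕.anti _ (by lia) hx.2⟩

theorem Z_pred_le_B (r i n : ℤ) : 𝓕.Z (r - 1) (i + 1) n ≤ 𝓕.B r i n := le_sup_left

/-- For `y ∈ Z_{r+1}^i` the element `d y` lies one filtration step deeper than required, hence in
`Z_{r-1}^{i+r+1} ⊆ B_r^{i+r}`. -/
theorem page_d_pageCls_of_mem_Z_succ {r i j : ℤ} (q : ℤ × ℤ) (y : 𝓕.Z (r + 1) i (i + j)) :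
    ((𝓕.page r).d (i, j) q).hom (𝓕.pageCls r i j ⟨y.1, 𝓕.Z_succ_le r i _ y.2⟩) = 0 := by
  by_cases h : ((i, j) : ℤ × ℤ) + ⟨r, 1 - r⟩ = q
  · obtain ⟨i', j'⟩ := q
    have hi : i + r = i' := congrArg Prod.fst h
    have hj : j + (1 - r) = j' := congrArg Prod.snd h
    rw [𝓕.page_d_pageCls hi hj _ ⟨_, 𝓕.d_mem_Z (by lia) hi (𝓕.Z_succ_le r i _ y.2)⟩ rfl,
      pageCls_eq_zero_iff]
    apply Z_pred_le_B
    exact 𝓕.d_mem_Z (by lia) (by lia) y.2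
  · rw [(𝓕.page r).shape _ _ h]
    rfl

/-- The cycle of the page `E_r` represented by an element of `Z_{r+1}^i`. -/
noncomputable def pageCycle (r i j : ℤ) :
    𝓕.Z (r + 1) i (i + j) →ₗ[R] (𝓕.page r).cycles (i, j) :=
  (𝓕.page r).liftCyclesLinear rfl
    (𝓕.pageCls r i j ∘ₗ Submodule.inclusion (𝓕.Z_succ_le r i (i + j)))
    fun y => 𝓕.page_d_pageCls_of_mem_Z_succ _ y

theorem iCycles_pageCycle (r i j : ℤ) (y : 𝓕.Z (r + 1) i (i + j)) :
    ((𝓕.page r).iCycles (i, j)).hom (𝓕.pageCycle r i j y) =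
      𝓕.pageCls r i j ⟨y.1, 𝓕.Z_succ_le r i _ y.2⟩ :=
  (𝓕.page r).iCycles_liftCyclesLinear _ _ _ y

theorem pageCycle_surjective (r i j : ℤ) : Function.Surjective (𝓕.pageCycle r i j) := by
  intro z
  obtain ⟨x, hx⟩ := 𝓕.pageCls_surjective r i j (((𝓕.page r).iCycles (i, j)).hom z)
  have hd := (𝓕.page r).d_iCycles_apply (i, j) (i + r, j + (1 - r)) z
  rw [← hx, 𝓕.page_d_pageCls rfl rfl x ⟨_, 𝓕.d_mem_Z (by lia) rfl x.2⟩ rfl,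
    pageCls_eq_zero_iff, 𝓕.mem_B_iff (m := i + j) (k := i + 1) (by lia) (by lia)] at hd
  -- Here `d x = y + d v` with `v ∈ Z_{r-1}^{i+1}` and `y` in `F^{i+r+1}`. Then `x - v` lies in
  -- `Z_{r+1}^i` and has the class of `x`.
  obtain ⟨y, hy, v, hv, hyv⟩ := hd
  replace hyv : y + _ = (K.d (i + j) (i + r + (j + (1 - r)))).hom x.1 := hyv
  have hmem : x.1 - v ∈ 𝓕.Z (r + 1) i (i + j) := by
    refine (𝓕.mem_Z_iff (m := i + r + (j + (1 - r))) (k := i + r + 1) (by lia) (by lia) _).2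
      ⟨sub_mem x.2.1 (𝓕.anti _ (by lia) hv.1), ?_⟩
    rw [map_sub, ← hyv, add_sub_cancel_right]
    exact hy.1
  refine ⟨⟨_, hmem⟩, (𝓕.page r).iCycles_injective _ ?_⟩
  rw [iCycles_pageCycle, ← hx, ← sub_eq_zero, ← map_sub, pageCls_eq_zero_iff]
  apply Z_pred_le_B
  have : x.1 - v - x.1 = -v := by abel
  change x.1 - v - x.1 ∈ _
  rw [this]
  exact neg_mem hv

theorem homologyπ_pageCycle_eq_zero_iff (r i j : ℤ) (y : 𝓕.Z (r + 1) i (i + j)) :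
    ((𝓕.page r).homologyπ (i, j)).hom (𝓕.pageCycle r i j y) = 0 ↔
      y.1 ∈ 𝓕.B (r + 1) i (i + j) := by
  have hprev : (ComplexShape.up' (⟨r, 1 - r⟩ : ℤ × ℤ)).prev (i, j) = (i - r, j - (1 - r)) :=
    ComplexShape.prev_eq' _ (by ext <;> simp)
  have hn : i - r + (j - (1 - r)) + 1 = i + j := by ring
  rw [HomologicalComplex.homologyπ_eq_zero_iff _ hprev, iCycles_pageCycle]
  constructor
  · rintro ⟨w, hw⟩
    obtain ⟨w, rfl⟩ := 𝓕.pageCls_surjective r _ _ w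
    rw [𝓕.page_d_pageCls (by lia) (by lia) w ⟨_, 𝓕.d_mem_Z hn (by lia) w.2⟩ rfl, ← sub_eq_zero,
      ← map_sub, pageCls_eq_zero_iff, 𝓕.mem_B_iff hn (k := i - r + 1) (by lia)] at hw
    obtain ⟨a, ha, b, hb, hab⟩ := hw
    have hab : a + (K.d (i - r + (j - (1 - r))) (i + j)).hom b =
      (K.d (i - r + (j - (1 - r))) (i + j)).hom w.1 - y.1 := hab
    have hy : -a + (K.d (i - r + (j - (1 - r))) (i + j)).hom (w.1 - b) = y.1 := by
      rw [map_sub, ← sub_eq_zero]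
      rw [← sub_eq_zero] at hab
      rw [← neg_eq_zero, ← hab]
      abel
    refine (𝓕.mem_B_iff hn (k := i - r) (by lia) _).2 ⟨-a, neg_mem ?_, w.1 - b, ?_, hy⟩
    -- A priori `a` is only in `Z_{r-1}^{i+1}`. Since `d a = -d y` and `y ∈ Z_{r+1}^i`, it is in
    -- `Z_r^{i+1}`.
    · refine (𝓕.mem_Z_iff rfl rfl _).2 ⟨ha.1, ?_⟩
      have : (K.d (i + j) (i + j + 1)).hom a = -(K.d (i + j) (i + j + 1)).hom y.1 := by
        rw [← hy, map_add, d_d_apply, add_zero, map_neg, neg_neg]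
      rw [this]
      exact neg_mem (𝓕.anti _ (by lia) y.2.2)
    · rw [add_sub_cancel_right]
      exact sub_mem w.2 ⟨𝓕.anti _ (by lia) hb.1, 𝓕.anti _ (by lia) hb.2⟩
  · intro hy
    obtain ⟨a, ha, b, hb, hab⟩ := (𝓕.mem_B_iff hn (k := i - r) (by lia) _).1 hy
    rw [add_sub_cancel_right] at ha hb
    refine ⟨𝓕.pageCls r _ _ ⟨b, hb⟩, ?_⟩
    rw [𝓕.page_d_pageCls (by lia) (by lia) _ ⟨_, 𝓕.d_mem_Z hn (by lia) hb⟩ rfl, ← sub_eq_zero,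
      ← map_sub, pageCls_eq_zero_iff]
    change (K.d (i - r + (j - (1 - r))) (i + j)).hom b - y.1 ∈ _
    have : (K.d (i - r + (j - (1 - r))) (i + j)).hom b - y.1 = -a := by
      rw [← hab]
      abel
    rw [this]
    exact 𝓕.Z_pred_le_B r i _ (neg_mem ⟨ha.1, 𝓕.anti _ (by lia) ha.2⟩)

/-- The isomorphism between the homology of `E_r` and `E_{r+1}`. -/
noncomputable def pageHomologyEquiv (r i j : ℤ) :
    (𝓕.page r).homology (i, j) ≃ₗ[R] (𝓕.page (r + 1)).X (i, j) :=
  LinearMap.equivOfKerEq (((𝓕.page r).homologyπ (i, j)).hom ∘ₗ 𝓕.pageCycle r i j)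
    (𝓕.pageCls (r + 1) i j)
    (((𝓕.page r).homologyπ_surjective _).comp (𝓕.pageCycle_surjective r i j))
    (𝓕.pageCls_surjective _ _ _)
    (by
      ext y
      exact (𝓕.homologyπ_pageCycle_eq_zero_iff r i j y).trans
        (𝓕.pageCls_eq_zero_iff (r + 1) i j y).symm)

theorem pageHomologyEquiv_apply (r i j : ℤ) (y : 𝓕.Z (r + 1) i (i + j)) :
    𝓕.pageHomologyEquiv r i j (((𝓕.page r).homologyπ (i, j)).hom (𝓕.pageCycle r i j y)) =
      𝓕.pageCls (r + 1) i j y :=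
  LinearMap.equivOfKerEq_apply (((𝓕.page r).homologyπ (i, j)).hom ∘ₗ 𝓕.pageCycle r i j) _ _ _ _ y

/-- The spectral sequence of a filtered complex. -/
noncomputable def associatedSpectralSequence : 𝓕.AssociatedSpectralSequence where
  E :=
    { page := fun r _ => 𝓕.page r
      iso := fun r r' p hr _ => by
        subst hr
        exact (𝓕.pageHomologyEquiv r p.1 p.2).toModuleIso }
  cls r _ i j := 𝓕.pageCls r i j
  cls_surjective r _ i j := 𝓕.pageCls_surjective r i j
  cls_eq_zero_iff r _ i j x := 𝓕.pageCls_eq_zero_iff r i j x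
  d_cls r _ i j i' j' hi hj x y hxy := 𝓕.page_d_pageCls hi hj x y hxy
  iso_cls r hr i j x y hxy z hz := by
    have : z = 𝓕.pageCycle r i j y := by
      refine (𝓕.page r).iCycles_injective _ (hz.trans ?_)
      rw [iCycles_pageCycle]
      exact congrArg _ (Subtype.ext hxy)
    rw [this]
    exact 𝓕.pageHomologyEquiv_apply r i j y

end ComplexFiltration

/-! ### The pages `E_0` and `E_1` and their differentials. -/

namespace ComplexFiltration

variable {R : Type w} [Ring R] {K : CochainComplex (ModuleCat.{v} R) ℤ} (𝓕 : ComplexFiltration K)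

theorem mem_Z_zero_iff (i n : ℤ) (x : K.X n) : x ∈ 𝓕.Z 0 i n ↔ x ∈ 𝓕.F i n := by
  rw [𝓕.mem_Z_iff rfl (add_zero i)]
  exact ⟨fun h => h.1, fun h => ⟨h, 𝓕.d_mem _ _ _ h⟩⟩

/-- At `r = 0` the definition involves `Z_{-1}^{i+1}`, where the condition `d c ∈ F^i` is automatic
for `c ∈ F^{i+1}`. -/
theorem mem_B_zero_iff (i n : ℤ) (x : K.X n) : x ∈ 𝓕.B 0 i n ↔ x ∈ 𝓕.F (i + 1) n := by
  rw [𝓕.mem_B_iff (m := n - 1) (k := i + 1) (by lia) (by lia)]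
  constructor
  · rintro ⟨y, hy, z, hz, rfl⟩
    exact add_mem hy.1 (𝓕.d_mem _ _ _ hz.1)
  · intro h
    refine ⟨x, ⟨h, 𝓕.anti _ (by lia) (𝓕.d_mem _ n (n + 1) h)⟩, 0, zero_mem _, ?_⟩
    rw [map_zero, add_zero]

/-- Since `Z_0 = F`, membership in `B_1^i` says that the class in `F^i / F^{i+1}` is a boundary of
the quotient complex. -/
theorem mem_B_one_iff {i n m : ℤ} (hm : m + 1 = n) (x : K.X n) :
    x ∈ 𝓕.B 1 i n ↔ ∃ w ∈ 𝓕.F i m, x - (K.d m n).hom w ∈ 𝓕.F (i + 1) n := by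
  rw [𝓕.mem_B_iff hm (k := i) (by lia), sub_self]
  simp only [mem_Z_zero_iff]
  constructor
  · rintro ⟨y, hy, z, hz, rfl⟩
    exact ⟨z, hz, by rwa [add_sub_cancel_right]⟩
  · rintro ⟨w, hw, h⟩
    exact ⟨_, h, w, hw, sub_add_cancel _ _⟩

theorem toQuot_surjective (a b n : ℤ) : Function.Surjective (𝓕.toQuot a b n) :=
  Submodule.mkQ_surjective _

theorem toQuot_eq_zero_iff (a b n : ℤ) (x : 𝓕.F a n) :
    𝓕.toQuot a b n x = 0 ↔ x.1 ∈ 𝓕.F b n :=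
  Submodule.Quotient.mk_eq_zero _

theorem quot_d_toQuot (a b n m : ℤ) (x : 𝓕.F a n) :
    ((𝓕.quot a b).d n m).hom (𝓕.toQuot a b n x) =
      𝓕.toQuot a b m ⟨(K.d n m).hom x.1, 𝓕.d_mem a n m x.2⟩ :=
  rfl

theorem quotMap_toQuot {a b a' b' : ℤ} (ha : a' ≤ a) (hb : b' ≤ b) (n : ℤ) (x : 𝓕.F a n) :
    ((𝓕.quotMap ha hb).f n).hom (𝓕.toQuot a b n x) = 𝓕.toQuot a' b' n ⟨x.1, 𝓕.anti n ha x.2⟩ :=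
  rfl

/-- The sequence of the triple `(F^{i+2}K, F^{i+1}K, F^iK)` is exact. -/
theorem triple_shortExact (i : ℤ) : (𝓕.triple i).ShortExact := by
  refine HomologicalComplex.shortExact_of_degreewise_shortExact _ fun n => ?_
  refine ModuleCat.shortComplex_shortExact _ ?_ ?_ ?_
  · intro x
    obtain ⟨x, rfl⟩ := 𝓕.toQuot_surjective i (i + 1 + 1) n x
    change 𝓕.toQuot i (i + 1) n x = 0 ↔ _
    rw [toQuot_eq_zero_iff]
    constructor
    · intro h
      exact ⟨𝓕.toQuot (i + 1) (i + 1 + 1) n ⟨x.1, h⟩, rfl⟩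
    · rintro ⟨y, hy⟩
      obtain ⟨y, rfl⟩ := 𝓕.toQuot_surjective (i + 1) (i + 1 + 1) n y
      have hy : 𝓕.toQuot i (i + 1 + 1) n ⟨y.1, 𝓕.anti n (by lia) y.2⟩ =
        𝓕.toQuot i (i + 1 + 1) n x := hy
      rw [← sub_eq_zero, ← map_sub, toQuot_eq_zero_iff] at hy
      have hy : y.1 - x.1 ∈ 𝓕.F (i + 1 + 1) n := hy
      exact (Submodule.sub_mem_iff_right _ y.2).1 (𝓕.anti n (by lia) hy)
  · rw [injective_iff_map_eq_zero]
    intro y hy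
    obtain ⟨y, rfl⟩ := 𝓕.toQuot_surjective (i + 1) (i + 1 + 1) n y
    have hy : 𝓕.toQuot i (i + 1 + 1) n ⟨y.1, 𝓕.anti n (by lia) y.2⟩ = 0 := hy
    exact (𝓕.toQuot_eq_zero_iff _ _ _ y).2 ((𝓕.toQuot_eq_zero_iff i _ _ _).1 hy)
  · intro x
    obtain ⟨x, rfl⟩ := 𝓕.toQuot_surjective i (i + 1) n x
    exact ⟨𝓕.toQuot i (i + 1 + 1) n x, rfl⟩

/-- The cycle of `F^iK/F^{i+1}K` represented by an element of `Z_1^i`. -/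
noncomputable def quotCycle (i n : ℤ) : 𝓕.Z 1 i n →ₗ[R] (𝓕.quot i (i + 1)).cycles n :=
  (𝓕.quot i (i + 1)).liftCyclesLinear (CochainComplex.next ℤ n)
    (𝓕.toQuot i (i + 1) n ∘ₗ Submodule.inclusion inf_le_left) fun x => by
      rw [LinearMap.comp_apply, quot_d_toQuot, toQuot_eq_zero_iff]
      exact x.2.2

theorem iCycles_quotCycle (i n : ℤ) (x : 𝓕.Z 1 i n) :
    ((𝓕.quot i (i + 1)).iCycles n).hom (𝓕.quotCycle i n x) =
      𝓕.toQuot i (i + 1) n ⟨x.1, x.2.1⟩ :=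
  (𝓕.quot i (i + 1)).iCycles_liftCyclesLinear _ _ _ x

theorem exists_mem_Z_one {i n : ℤ} (x : 𝓕.F i n) (z : (𝓕.quot i (i + 1)).cycles n)
    (h : ((𝓕.quot i (i + 1)).iCycles n).hom z = 𝓕.toQuot i (i + 1) n x) :
    ∃ hx : x.1 ∈ 𝓕.Z 1 i n, 𝓕.quotCycle i n ⟨x.1, hx⟩ = z := by
  have hd := (𝓕.quot i (i + 1)).d_iCycles_apply n (n + 1) z
  rw [h, quot_d_toQuot, toQuot_eq_zero_iff] at hd
  refine ⟨⟨x.2, hd⟩, (𝓕.quot i (i + 1)).iCycles_injective n ?_⟩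
  rw [h, iCycles_quotCycle]

theorem quotCycle_surjective (i n : ℤ) : Function.Surjective (𝓕.quotCycle i n) := by
  intro z
  obtain ⟨x, hx⟩ := 𝓕.toQuot_surjective i (i + 1) n (((𝓕.quot i (i + 1)).iCycles n).hom z)
  obtain ⟨hx', h⟩ := 𝓕.exists_mem_Z_one x z hx.symm
  exact ⟨_, h⟩

theorem homologyπ_quotCycle_eq_zero_iff (i n : ℤ) (x : 𝓕.Z 1 i n) :
    ((𝓕.quot i (i + 1)).homologyπ n).hom (𝓕.quotCycle i n x) = 0 ↔ x.1 ∈ 𝓕.B 1 i n := by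
  rw [HomologicalComplex.homologyπ_eq_zero_iff _ (CochainComplex.prev ℤ n), iCycles_quotCycle,
    𝓕.mem_B_one_iff (sub_add_cancel n 1)]
  constructor
  · rintro ⟨w, hw⟩
    obtain ⟨w, rfl⟩ := 𝓕.toQuot_surjective i (i + 1) _ w
    rw [quot_d_toQuot, eq_comm, ← sub_eq_zero, ← map_sub, toQuot_eq_zero_iff] at hw
    exact ⟨w.1, w.2, hw⟩
  · rintro ⟨w, hw, h⟩
    refine ⟨𝓕.toQuot i (i + 1) _ ⟨w, hw⟩, ?_⟩
    rw [quot_d_toQuot, eq_comm, ← sub_eq_zero, ← map_sub, toQuot_eq_zero_iff]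
    exact h

/-- The connecting homomorphism of the triple is `x ↦ d x` on representatives. -/
theorem triple_δ_apply {i n m : ℤ} (hm : n + 1 = m) (x : 𝓕.Z 1 i n) (y : 𝓕.Z 1 (i + 1) m)
    (hxy : (K.d n m).hom x.1 = y.1) :
    ((𝓕.triple_shortExact i).δ n m hm).hom
        (((𝓕.quot i (i + 1)).homologyπ n).hom (𝓕.quotCycle i n x)) =
      ((𝓕.quot (i + 1) (i + 1 + 1)).homologyπ m).hom (𝓕.quotCycle (i + 1) m y) := by
  have hx₃ : ((𝓕.quot i (i + 1)).d n m).hom (𝓕.toQuot i (i + 1) n ⟨x.1, x.2.1⟩) = 0 := by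
    rw [quot_d_toQuot, toQuot_eq_zero_iff]
    exact ((𝓕.mem_Z_iff hm rfl _).1 x.2).2
  have hx₁ : ((𝓕.quotMap (by lia) le_rfl).f m).hom
      (𝓕.toQuot (i + 1) (i + 1 + 1) m ⟨y.1, y.2.1⟩) =
        ((𝓕.quot i (i + 1 + 1)).d n m).hom (𝓕.toQuot i (i + 1 + 1) n ⟨x.1, x.2.1⟩) := by
    rw [quotMap_toQuot, quot_d_toQuot]
    exact congrArg _ (Subtype.ext hxy.symm)
  -- Snake lemma with the same `x` as lift to `F^i / F^{i+2}`; its coboundary there is the image of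
  -- `y`.
  have h := (𝓕.triple_shortExact i).δ_apply n m hm (𝓕.toQuot i (i + 1) n ⟨x.1, x.2.1⟩) hx₃
    (𝓕.toQuot i (i + 1 + 1) n ⟨x.1, x.2.1⟩) rfl (𝓕.toQuot (i + 1) (i + 1 + 1) m ⟨y.1, y.2.1⟩) hx₁
    (m + 1) (CochainComplex.next ℤ m)
  have h₃ : (𝓕.triple i).X₃.cyclesMk (𝓕.toQuot i (i + 1) n ⟨x.1, x.2.1⟩) m
      (ComplexShape.next_eq' _ hm) hx₃ = 𝓕.quotCycle i n x := by
    refine (𝓕.quot i (i + 1)).iCycles_injective n ?_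
    rw [iCycles_quotCycle]
    exact (𝓕.triple i).X₃.i_cyclesMk (𝓕.toQuot i (i + 1) n ⟨x.1, x.2.1⟩) m
      (ComplexShape.next_eq' _ hm) hx₃
  have h₁ : ∀ e, (𝓕.triple i).X₁.cyclesMk (𝓕.toQuot (i + 1) (i + 1 + 1) m ⟨y.1, y.2.1⟩) (m + 1)
      (CochainComplex.next ℤ m) e = 𝓕.quotCycle (i + 1) m y := by
    intro e
    refine (𝓕.quot (i + 1) (i + 1 + 1)).iCycles_injective m ?_
    rw [iCycles_quotCycle]
    exact (𝓕.triple i).X₁.i_cyclesMk (𝓕.toQuot (i + 1) (i + 1 + 1) m ⟨y.1, y.2.1⟩) (m + 1)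
      (CochainComplex.next ℤ m) e
  rw [h₃, h₁] at h
  exact h

namespace AssociatedSpectralSequence

variable {𝓕} (S : 𝓕.AssociatedSpectralSequence)

/-- The identification of `E_0^{i,j}` with `F^iK^{i+j}/F^{i+1}K^{i+j}`. -/
noncomputable def pageZeroIso (i j : ℤ) :
    (S.E.page 0 le_rfl).X (i, j) ≅ (𝓕.quot i (i + 1)).X (i + j) :=
  (LinearMap.equivOfKerEq (S.cls 0 le_rfl i j)
    (𝓕.toQuot i (i + 1) (i + j) ∘ₗ Submodule.inclusion inf_le_left)
    (S.cls_surjective _ _ _ _)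
    (fun y => by
      obtain ⟨x, rfl⟩ := 𝓕.toQuot_surjective _ _ _ y
      exact ⟨⟨x.1, (𝓕.mem_Z_zero_iff _ _ _).2 x.2⟩, rfl⟩)
    (by
      ext x
      exact (S.cls_eq_zero_iff 0 le_rfl i j x).trans
        ((𝓕.mem_B_zero_iff _ _ _).trans (𝓕.toQuot_eq_zero_iff _ _ _ ⟨x.1, x.2.1⟩).symm))).toModuleIso

theorem pageZeroIso_cls (i j : ℤ) (x : 𝓕.Z 0 i (i + j)) :
    (S.pageZeroIso i j).hom.hom (S.cls 0 le_rfl i j x) =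
      𝓕.toQuot i (i + 1) (i + j) ⟨x.1, x.2.1⟩ :=
  LinearMap.equivOfKerEq_apply (S.cls 0 le_rfl i j) _ _ _ _ x

theorem pageZeroIso_d (i j : ℤ) :
    (S.E.page 0 le_rfl).d (i, j) (i, j + 1) ≫ (S.pageZeroIso i (j + 1)).hom =
      (S.pageZeroIso i j).hom ≫ (𝓕.quot i (i + 1)).d (i + j) (i + (j + 1)) := by
  apply ModuleCat.hom_ext
  refine LinearMap.ext fun e => ?_
  obtain ⟨x, rfl⟩ := S.cls_surjective 0 le_rfl i j e
  change (S.pageZeroIso i (j + 1)).hom.hom (((S.E.page 0 le_rfl).d (i, j) (i, j + 1)).hom _) =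
    ((𝓕.quot i (i + 1)).d (i + j) (i + (j + 1))).hom ((S.pageZeroIso i j).hom.hom _)
  rw [S.d_cls 0 le_rfl i j i (j + 1) (by lia) (by lia) x
    ⟨_, (𝓕.mem_Z_zero_iff _ _ _).2 (𝓕.d_mem _ _ _ x.2.1)⟩ rfl, pageZeroIso_cls, pageZeroIso_cls,
    quot_d_toQuot]

/-- The identification of `E_1^{i,j}` with `H^{i+j}(F^iK/F^{i+1}K)`. -/
noncomputable def pageOneIso (i j : ℤ) :
    (S.E.page 1 zero_le_one).X (i, j) ≅ (𝓕.quot i (i + 1)).homology (i + j) :=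
  (LinearMap.equivOfKerEq (S.cls 1 zero_le_one i j)
    (((𝓕.quot i (i + 1)).homologyπ (i + j)).hom ∘ₗ 𝓕.quotCycle i (i + j))
    (S.cls_surjective _ _ _ _)
    (((𝓕.quot i (i + 1)).homologyπ_surjective _).comp (𝓕.quotCycle_surjective _ _))
    (by
      ext x
      exact (S.cls_eq_zero_iff 1 zero_le_one i j x).trans
        (𝓕.homologyπ_quotCycle_eq_zero_iff _ _ _).symm)).toModuleIso

theorem pageOneIso_cls (i j : ℤ) (x : 𝓕.Z 1 i (i + j)) :
    (S.pageOneIso i j).hom.hom (S.cls 1 zero_le_one i j x) =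
      ((𝓕.quot i (i + 1)).homologyπ (i + j)).hom (𝓕.quotCycle i (i + j) x) :=
  LinearMap.equivOfKerEq_apply (S.cls 1 zero_le_one i j) _ _ _ _ x

/-- A representative `x` of `z` maps to a cycle of `F^i / F^{i+1}`, so it already lies in `Z_1^i`.
The passage to `E_1` is the identity on representatives. -/
theorem pageOneIso_iso_homologyπ (i j : ℤ) (z : (S.E.page 0 le_rfl).cycles (i, j))
    (y : (𝓕.quot i (i + 1)).cycles (i + j))
    (h : ((𝓕.quot i (i + 1)).iCycles (i + j)).hom y =
      (S.pageZeroIso i j).hom.hom (((S.E.page 0 le_rfl).iCycles (i, j)).hom z)) :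
    (S.pageOneIso i j).hom.hom
        ((S.E.iso 0 1 (i, j) (zero_add 1) le_rfl).hom.hom (((S.E.page 0 le_rfl).homologyπ (i, j)).hom z)) =
      ((𝓕.quot i (i + 1)).homologyπ (i + j)).hom y := by
  obtain ⟨x, hx⟩ := S.cls_surjective 0 le_rfl i j (((S.E.page 0 le_rfl).iCycles (i, j)).hom z)
  rw [← hx, pageZeroIso_cls] at h
  obtain ⟨hx', rfl⟩ := 𝓕.exists_mem_Z_one _ y h
  rw [← pageOneIso_cls]
  exact congrArg _ (S.iso_cls 0 le_rfl i j x ⟨x.1, hx'⟩ rfl z hx.symm)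

theorem pageOneIso_d (i j : ℤ) :
    (S.E.page 1 zero_le_one).d (i, j) (i + 1, j) ≫ (S.pageOneIso (i + 1) j).hom =
      (S.pageOneIso i j).hom ≫ (𝓕.triple_shortExact i).δ (i + j) (i + 1 + j)
        (add_right_comm i j 1) := by
  apply ModuleCat.hom_ext
  refine LinearMap.ext fun e => ?_
  obtain ⟨x, rfl⟩ := S.cls_surjective 1 zero_le_one i j e
  have hm : i + j + 1 = i + 1 + j := by ring
  change (S.pageOneIso (i + 1) j).hom.hom (((S.E.page 1 zero_le_one).d (i, j) (i + 1, j)).hom _) =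
    ((𝓕.triple_shortExact i).δ (i + j) (i + 1 + j) hm).hom ((S.pageOneIso i j).hom.hom _)
  rw [S.d_cls 1 zero_le_one i j (i + 1) j rfl (by lia) x ⟨_, 𝓕.d_mem_Z hm rfl x.2⟩ rfl,
    pageOneIso_cls, pageOneIso_cls, 𝓕.triple_δ_apply hm x ⟨_, 𝓕.d_mem_Z hm rfl x.2⟩ rfl]

/-- `E_r^{i,j}` vanishes if the filtration does not jump there. -/
theorem isZero_of_F_le {r : ℤ} (hr : 0 ≤ r) {i j : ℤ}
    (h : 𝓕.F i (i + j) ≤ 𝓕.F (i + 1) (i + j)) : Limits.IsZero ((S.E.page r hr).X (i, j)) := by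
  have : Subsingleton ((S.E.page r hr).X (i, j)) := by
    refine subsingleton_of_forall_eq 0 fun e => ?_
    obtain ⟨x, rfl⟩ := S.cls_surjective r hr i j e
    rw [cls_eq_zero_iff]
    exact 𝓕.Z_pred_le_B _ _ _ ((𝓕.mem_Z_iff rfl (by lia) _).2 ⟨h x.2.1, x.2.2⟩)
  exact ModuleCat.isZero_of_subsingleton _

end AssociatedSpectralSequence

/-! ### Convergence for a bounded filtration. -/

/-- The cycle of `K` given by an element of `Z_r^i` when `F^{i+r}K = 0`. -/
noncomputable def zCycle {r i n : ℤ} (h : 𝓕.F (i + r) (n + 1) = ⊥) : 𝓕.Z r i n →ₗ[R] K.cycles n :=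
  K.liftCyclesLinear (CochainComplex.next ℤ n) (𝓕.Z r i n).subtype fun x => by
    have := x.2.2
    rw [h] at this
    exact this

theorem iCycles_zCycle {r i n : ℤ} (h : 𝓕.F (i + r) (n + 1) = ⊥) (x : 𝓕.Z r i n) :
    (K.iCycles n).hom (𝓕.zCycle h x) = x.1 :=
  K.iCycles_liftCyclesLinear _ _ _ x

theorem mem_onCohomology_iff (i n : ℤ) (h : K.homology n) :
    h ∈ 𝓕.onCohomology i n ↔
      ∃ z : K.cycles n, (K.iCycles n).hom z ∈ 𝓕.F i n ∧ (K.homologyπ n).hom z = h := by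
  constructor
  · rintro ⟨y, rfl⟩
    obtain ⟨z, rfl⟩ := (𝓕.sub i).homologyπ_surjective n y
    refine ⟨(HomologicalComplex.cyclesMap (𝓕.incl i) n).hom z, ?_, ?_⟩
    · have : (K.iCycles n).hom ((HomologicalComplex.cyclesMap (𝓕.incl i) n).hom z) =
          (((𝓕.sub i).iCycles n).hom z : 𝓕.F i n).1 :=
        congrArg (fun g => g.hom z) (HomologicalComplex.cyclesMap_i (𝓕.incl i) n)
      rw [this]
      exact Subtype.property _
    · exact congrArg (fun g => g.hom z)
        (HomologicalComplex.homologyπ_naturality (𝓕.incl i) n).symm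
  · rintro ⟨z, hz, rfl⟩
    -- To lift the single cycle `z` to `F^i K`, its span serves as the source of a linear map;
    -- unlike `R`, it lives in the universe `v` of the modules.
    let f : Submodule.span R {z} →ₗ[R] 𝓕.F i n :=
      ((K.iCycles n).hom ∘ₗ Submodule.subtype _).codRestrict (𝓕.F i n) fun y => by
        obtain ⟨c, hc⟩ := Submodule.mem_span_singleton.1 y.2
        rw [LinearMap.comp_apply, Submodule.subtype_apply, ← hc, map_smul]
        exact Submodule.smul_mem _ _ hz
    let l := (𝓕.sub i).liftCyclesLinear (CochainComplex.next ℤ n) f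
      fun y => Subtype.ext (K.d_iCycles_apply n (n + 1) y.1)
    obtain ⟨y, hy⟩ : ∃ y : (𝓕.sub i).cycles n,
        (HomologicalComplex.cyclesMap (𝓕.incl i) n).hom y = z := by
      refine ⟨l ⟨z, Submodule.mem_span_singleton_self z⟩, K.iCycles_injective n ?_⟩
      have h₁ : (K.iCycles n).hom ((HomologicalComplex.cyclesMap (𝓕.incl i) n).hom
          (l ⟨z, Submodule.mem_span_singleton_self z⟩)) =
          ((𝓕.incl i).f n).hom (((𝓕.sub i).iCycles n).hom _) :=
        congrArg (fun g => g.hom (l ⟨z, Submodule.mem_span_singleton_self z⟩))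
          (HomologicalComplex.cyclesMap_i (𝓕.incl i) n)
      exact h₁.trans (congrArg ((𝓕.incl i).f n).hom
        ((𝓕.sub i).iCycles_liftCyclesLinear (CochainComplex.next ℤ n) f _ _))
    refine ⟨((𝓕.sub i).homologyπ n).hom y, ?_⟩
    rw [← hy]
    exact congrArg (fun g => g.hom y)
      (HomologicalComplex.homologyπ_naturality (𝓕.incl i) n)

theorem onCohomology_eq_top {i n : ℤ} (h : 𝓕.F i n = ⊤) : 𝓕.onCohomology i n = ⊤ := by
  refine eq_top_iff.2 fun y _ => ?_
  obtain ⟨z, rfl⟩ := K.homologyπ_surjective n y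
  exact (𝓕.mem_onCohomology_iff i n _).2 ⟨z, h ▸ Submodule.mem_top, rfl⟩

theorem onCohomology_eq_bot {i n : ℤ} (h : 𝓕.F i n = ⊥) : 𝓕.onCohomology i n = ⊥ := by
  refine eq_bot_iff.2 fun y hy => ?_
  obtain ⟨z, hz, rfl⟩ := (𝓕.mem_onCohomology_iff i n _).1 hy
  rw [h] at hz
  have hz : z = 0 := K.iCycles_injective n (hz.trans (map_zero _).symm)
  rw [hz, map_zero]
  exact zero_mem _

namespace AssociatedSpectralSequence

variable {𝓕} (S : 𝓕.AssociatedSpectralSequence)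

/-- The spectral sequence of a filtration with `F^a K = K` and `F^b K = 0` for some `a` and `b`
converges to the cohomology of `K`. -/
theorem converges_of_bounded {a b : ℤ} (ha : ∀ k n, k ≤ a → 𝓕.F k n = ⊤)
    (hb : ∀ k n, b ≤ k → 𝓕.F k n = ⊥) : S.Converges := by
  refine ⟨fun n => ⟨⟨a, 𝓕.onCohomology_eq_top (ha a n le_rfl)⟩,
    ⟨b, 𝓕.onCohomology_eq_bot (hb b n le_rfl)⟩⟩, fun i j => ⟨max (b - i) (i - a + 1), ?_⟩⟩
  intro r hr hr₀
  -- The bound on `r` makes `F^{i+r} = 0` and `F^{i-r+1} = K`. So the target of the outgoing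
  -- differential and the source of the incoming one vanish, and elements of `Z_r^i` are cocycles.
  have hbr : b ≤ i + r := by have := le_max_left (b - i) (i - a + 1); lia
  have har : i - r + 1 ≤ a := by have := le_max_right (b - i) (i - a + 1); lia
  refine ⟨fun p => ⟨?_, ?_⟩, ?_⟩
  · by_cases h : ((i, j) : ℤ × ℤ) + ⟨r, 1 - r⟩ = p
    · subst h
      exact (S.isZero_of_F_le hr (i := i + r) (j := j + (1 - r))
        (by rw [hb _ _ hbr]; exact bot_le)).eq_of_tgt _ _
    · exact (S.E.page r hr).shape _ _ h
  · by_cases h : p + ⟨r, 1 - r⟩ = ((i, j) : ℤ × ℤ)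
    · obtain ⟨p, q⟩ := p
      have hp : p + r = i := congrArg Prod.fst h
      exact (S.isZero_of_F_le hr (i := p) (j := q)
        (by rw [ha (p + 1) _ (by lia)]; exact le_top)).eq_of_src _ _
    · exact (S.E.page r hr).shape _ _ h
  · have hbot := hb (i + r) (i + j + 1) hbr
    have hF : ∀ x : 𝓕.Z r i (i + j),
        (K.homologyπ (i + j)).hom (𝓕.zCycle hbot x) ∈ 𝓕.onCohomology i (i + j) := fun x =>
      (𝓕.mem_onCohomology_iff _ _ _).2 ⟨_, by rw [iCycles_zCycle]; exact x.2.1, rfl⟩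
    let g : 𝓕.Z r i (i + j) →ₗ[R] (𝓕.onCohomology i (i + j) ⧸
        (𝓕.onCohomology (i + 1) (i + j)).submoduleOf (𝓕.onCohomology i (i + j))) :=
      Submodule.mkQ _ ∘ₗ
        ((K.homologyπ (i + j)).hom ∘ₗ 𝓕.zCycle hbot).codRestrict _ hF
    have hg : Function.Surjective g := by
      refine (Submodule.mkQ_surjective _).comp ?_
      rintro ⟨y, hy⟩
      obtain ⟨z, hz, rfl⟩ := (𝓕.mem_onCohomology_iff _ _ _).1 hy
      refine ⟨⟨(K.iCycles (i + j)).hom z, hz, ?_⟩,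
        Subtype.ext (congrArg (K.homologyπ (i + j)).hom ?_)⟩
      · change (K.d _ _).hom _ ∈ 𝓕.F _ _
        rw [K.d_iCycles_apply]
        exact zero_mem _
      · exact K.iCycles_injective (i + j) (𝓕.iCycles_zCycle hbot _)
    -- Both kernels consist of the `x` that are cohomologous to a cocycle of `F^{i+1}`. The cochain
    -- `w` realizing this is in `Z_{r-1}^{i-r+1}` for free, because `F^{i-r+1} = K` and `d w ∈ F^i`.
    have hker : LinearMap.ker (S.cls r hr i j) = LinearMap.ker g := by
      ext x
      rw [LinearMap.mem_ker, LinearMap.mem_ker, S.cls_eq_zero_iff,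
        𝓕.mem_B_iff (sub_add_cancel (i + j) 1) (k := i - r + 1) (by lia)]
      have hgx : g x = 0 ↔
          (K.homologyπ (i + j)).hom (𝓕.zCycle hbot x) ∈ 𝓕.onCohomology (i + 1) (i + j) :=
        Submodule.Quotient.mk_eq_zero _
      rw [hgx, mem_onCohomology_iff]
      have key : ∀ z : K.cycles (i + j),
          (K.homologyπ (i + j)).hom z = (K.homologyπ (i + j)).hom (𝓕.zCycle hbot x) ↔
            ∃ w, (K.d (i + j - 1) (i + j)).hom w = x.1 - (K.iCycles (i + j)).hom z := by
        intro z
        rw [eq_comm, ← sub_eq_zero, ← map_sub,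
          HomologicalComplex.homologyπ_eq_zero_iff _ (CochainComplex.prev ℤ (i + j)), map_sub,
          iCycles_zCycle]
      constructor
      · rintro ⟨y, hy, w, hw, hyw⟩
        have hy' : (K.d (i + j) (i + j + 1)).hom y = 0 := by
          have := ((𝓕.mem_Z_iff rfl (show i + 1 + (r - 1) = i + r by ring) _).1 hy).2
          rw [hbot] at this
          exact this
        have hy0 : (K.d (i + j) (i + j + 1)).hom y ∈ 𝓕.F (i + r) (i + j + 1) := by
          rw [hy']
          exact zero_mem _
        let y' : 𝓕.Z r i (i + j) := ⟨y, 𝓕.anti _ (by lia) hy.1, hy0⟩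
        refine ⟨𝓕.zCycle hbot y', ?_, (key _).2 ⟨w, ?_⟩⟩
        · rw [iCycles_zCycle]
          exact hy.1
        · rw [iCycles_zCycle, ← hyw, add_sub_cancel_left]
      · rintro ⟨z, hz, h⟩
        obtain ⟨w, hw⟩ := (key z).1 h
        refine ⟨(K.iCycles (i + j)).hom z, ⟨hz, ?_⟩, w, ?_, ?_⟩
        · change (K.d _ _).hom _ ∈ 𝓕.F _ _
          rw [K.d_iCycles_apply]
          exact zero_mem _
        · refine (𝓕.mem_Z_iff (sub_add_cancel (i + j) 1) (show i - r + 1 + (r - 1) = i by ring) _).2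
            ⟨?_, ?_⟩
          · rw [ha _ _ har]
            exact Submodule.mem_top
          · rw [hw]
            exact sub_mem x.2.1 (𝓕.anti _ (by lia) hz)
        · rw [hw, add_sub_cancel]
    refine ⟨LinearMap.equivOfKerEq (S.cls r hr i j) g (S.cls_surjective _ _ _ _) hg hker,
      fun x z hz => ?_⟩
    obtain rfl : 𝓕.zCycle hbot x = z := K.iCycles_injective _ (by rw [iCycles_zCycle, hz])
    exact ⟨hF x, LinearMap.equivOfKerEq_apply _ _ _ _ _ x⟩

end AssociatedSpectralSequence

end ComplexFiltration

/-! ### The geometric representation and Chebyshev polynomials. -/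

namespace CoxeterMatrix

open Polynomial.Chebyshev Real

variable {B : Type*} (M : CoxeterMatrix B)

/-- The Cartan pairing `-2 cos (π / m(i,j))` of two simple roots. -/
noncomputable def cartanEntry (i j : B) : ℝ := if M i j = 0 then -2 else -2 * cos (π / M i j)

theorem cartanEntry_symm (i j : B) : M.cartanEntry i j = M.cartanEntry j i := by
  simp only [cartanEntry, M.symmetric i j]

theorem cartanEntry_self (i : B) : M.cartanEntry i i = 2 := by
  simp [cartanEntry]

/-- The simple coroot, as a linear form on the space of the geometric representation. -/
noncomputable def simpleCoroot (i : B) : Module.Dual ℝ (B →₀ ℝ) :=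
  Finsupp.linearCombination ℝ (M.cartanEntry i)

theorem simpleCoroot_single (i j : B) :
    M.simpleCoroot i (Finsupp.single j 1) = M.cartanEntry i j := by
  simp [simpleCoroot]

theorem simpleCoroot_self (i : B) : M.simpleCoroot i (Finsupp.single i 1) = 2 := by
  rw [simpleCoroot_single, cartanEntry_self]

/-- The reflection by which a simple generator acts in the geometric representation. -/
noncomputable def simpleReflection (i : B) : (B →₀ ℝ) ≃ₗ[ℝ] (B →₀ ℝ) :=
  Module.reflection (M.simpleCoroot_self i)

/-- The left side is the trace of the product of two simple reflections on the plane of their roots,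
the parameter in the Chebyshev formula for its powers. -/
theorem trace_eq_of_ne_zero {i j : B} (h : M i j ≠ 0) :
    M.simpleCoroot i (Finsupp.single j 1) * M.simpleCoroot j (Finsupp.single i 1) - 2 =
      2 * cos (2 * π / M i j) := by
  rw [simpleCoroot_single, simpleCoroot_single, M.cartanEntry_symm j i, cartanEntry, if_neg h,
    mul_div_assoc, cos_two_mul]
  ring

theorem sin_pos_of_three_le {m : ℕ} (hm : 3 ≤ m) : 0 < sin (2 * π / m) := by
  have hm' : (3 : ℝ) ≤ m := by exact_mod_cast hm
  apply sin_pos_of_pos_of_lt_pi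
  · positivity
  · rw [div_lt_iff₀ (by linarith)]
    nlinarith [pi_pos]

/-- Powers of a product of two reflections have coefficients in the Chebyshev polynomials `S_n` at
`2 cos θ`, `θ = 2π/m`. The identity `S_n(2 cos θ) sin θ = sin ((n+1)θ)` makes them vanish at the
power `m`, provided `sin θ ≠ 0`; so `m = 2` is treated apart. -/
theorem simpleReflection_isLiftable : M.IsLiftable M.simpleReflection := by
  intro i j
  by_cases hij : i = j
  · subst hij
    rw [M.diagonal, pow_one, mul_eq_one_iff_eq_inv]
    exact (Module.reflection_inv _).symm
  by_cases h0 : M i j = 0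
  · rw [h0, pow_zero]
  have h1 : M i j ≠ 1 := M.off_diagonal i j hij
  have ht := M.trace_eq_of_ne_zero h0
  apply LinearEquiv.ext
  intro z
  rw [simpleReflection, simpleReflection, Module.reflection_mul_reflection_pow_apply _ _ _ _ _ ht.symm]
  generalize hm : M i j = m at *
  by_cases h2 : m = 2
  · subst h2
    have hc : M.cartanEntry i j = 0 := by simp [cartanEntry, hm]
    simp only [simpleCoroot_single, M.cartanEntry_symm j i, hc]
    norm_num
    abel
  · have hm3 : 3 ≤ m := by lia
    have hs := (sin_pos_of_three_le hm3).ne'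
    have hm0 : (m : ℝ) ≠ 0 := by exact_mod_cast h0
    have hz : ∀ n : ℤ, sin ((n + 1) * (2 * π / m)) = 0 →
        (S ℝ n).eval (2 * cos (2 * π / m)) = 0 := by
      intro n hn
      rw [← S_two_mul_real_cos] at hn
      exact (mul_eq_zero.1 hn).resolve_right hs
    obtain ⟨p, rfl | rfl⟩ := Nat.even_or_odd' m
    · have e₁ : (((2 * p : ℕ) : ℤ) - 2) / 2 = p - 1 := by lia
      have e₂ : (((2 * p : ℕ) : ℤ) - 1) / 2 = p - 1 := by lia
      have hp : (p : ℝ) ≠ 0 := by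
        rintro h
        exact hm0 (by push_cast; rw [h, mul_zero])
      -- For `m = 2p` one has `pθ = π`.
      have : (S ℝ ((p : ℤ) - 1)).eval (2 * cos (2 * π / (2 * p : ℕ))) = 0 := by
        apply hz
        have : (((p : ℤ) - 1 : ℤ) + 1 : ℝ) * (2 * π / (2 * p : ℕ)) = π := by
          push_cast
          field_simp
          ring
        rw [this, sin_pi]
      rw [e₁, e₂, this]
      simp
    · have e₁ : (((2 * p + 1 : ℕ) : ℤ) - 2) / 2 = p - 1 := by lia
      have e₂ : (((2 * p + 1 : ℕ) : ℤ) - 1) / 2 = p := by lia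
      have e₃ : (((2 * p + 1 : ℕ) : ℤ) - 3) / 2 = p - 1 := by lia
      have e₄ : ((2 * p + 1 : ℕ) : ℤ) / 2 = p := by lia
      -- For `m = 2p + 1` one has `(p+1)θ = 2π - pθ`, so the two sines cancel.
      have : (S ℝ (p : ℤ)).eval (2 * cos (2 * π / (2 * p + 1 : ℕ))) +
          (S ℝ ((p : ℤ) - 1)).eval (2 * cos (2 * π / (2 * p + 1 : ℕ))) = 0 := by
        refine (mul_eq_zero.1 ?_).resolve_right hs
        rw [add_mul, S_two_mul_real_cos, S_two_mul_real_cos]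
        have : (((p : ℤ) : ℝ) + 1) * (2 * π / (2 * p + 1 : ℕ)) =
            2 * π - (((p : ℤ) - 1 : ℤ) + 1 : ℝ) * (2 * π / (2 * p + 1 : ℕ)) := by
          push_cast at hm0 ⊢
          field_simp
          ring
        rw [this, sin_two_pi_sub]
        ring
      rw [e₁, e₂, e₃, e₄, this]
      simp

/-- Evaluate on the root of `i`. For `m = ∞` the trace is `2` and the other coordinate is a nonzero
multiple of `S_{n-1}(2) = n`. For `3 ≤ m < ∞` the coordinates force `sin nθ = 0` and `cos nθ = 1`,
whence `m ∣ n`. -/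
theorem simpleReflection_mul_pow_ne_one {i j : B} (hij : i ≠ j) {n : ℕ} (hn : n ≠ 0)
    (hlt : M i j = 0 ∨ n < M i j) :
    (M.simpleReflection i * M.simpleReflection j) ^ n ≠ 1 := by
  intro h
  have hx := LinearEquiv.congr_fun h (Finsupp.single i 1)
  rw [simpleReflection, simpleReflection,
    Module.reflection_mul_reflection_pow_apply_self _ _ n] at hx
  have hi := DFunLike.congr_fun hx i
  have hj := DFunLike.congr_fun hx j
  simp only [LinearEquiv.coe_one, id_eq, Finsupp.add_apply, Finsupp.smul_apply,
    Finsupp.single_eq_same, Finsupp.single_eq_of_ne hij, Finsupp.single_eq_of_ne hij.symm,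
    smul_eq_mul, mul_one, mul_zero, add_zero, zero_add] at hi hj
  by_cases h0 : M i j = 0
  · have hc : M.cartanEntry j i = -2 := by simp [cartanEntry, M.symmetric j i, h0]
    have hc' : M.cartanEntry i j = -2 := by simp [cartanEntry, h0]
    rw [simpleCoroot_single, simpleCoroot_single, hc, hc'] at hj
    norm_num at hj
    exact hn hj
  · have hlt := hlt.resolve_left h0
    have h1 : M i j ≠ 1 := M.off_diagonal i j hij
    rw [M.trace_eq_of_ne_zero h0] at hi hj
    have hc : M.cartanEntry j i = -2 * cos (π / M i j) := by
      rw [M.cartanEntry_symm, cartanEntry, if_neg h0]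
    rw [simpleCoroot_single, hc] at hj
    generalize M i j = m at *
    have hm0 : (m : ℝ) ≠ 0 := by exact_mod_cast h0
    by_cases h2 : m = 2
    · subst h2
      obtain rfl : n = 1 := by lia
      norm_num at hi
    have hm3 : 3 ≤ m := by lia
    have hs := (sin_pos_of_three_le hm3).ne'
    have hcos : cos (π / m) ≠ 0 := by
      intro hcos
      apply hs
      rw [mul_div_assoc, sin_two_mul, hcos, mul_zero]
    have hS : (S ℝ ((n : ℤ) - 1)).eval (2 * cos (2 * π / m)) = 0 := by
      refine (mul_eq_zero.1 hj).resolve_right ?_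
      simpa using hcos
    rw [hS, add_zero] at hi
    have hsin : sin (n * (2 * π / m)) = 0 := by
      have := S_two_mul_real_cos (2 * π / m) ((n : ℤ) - 1)
      rw [hS, zero_mul] at this
      rw [this]
      push_cast
      ring_nf
    have hcosn : cos (n * (2 * π / m)) = 1 := by
      have := S_two_mul_real_cos (2 * π / m) (n : ℤ)
      rw [hi, one_mul, Int.cast_natCast, add_mul, one_mul, sin_add, hsin, zero_mul, zero_add] at this
      exact mul_right_cancel₀ hs (by rw [one_mul, ← this])
    obtain ⟨k, hk⟩ := (cos_eq_one_iff _).1 hcosn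
    have hk' : (k * m : ℝ) = n := by
      have hpi := pi_ne_zero
      field_simp at hk
      linarith
    have hk'' : k * m = n := by exact_mod_cast hk'
    have hdvd : (m : ℤ) ∣ n := ⟨k, by rw [← hk'', mul_comm]⟩
    exact absurd (Nat.le_of_dvd (Nat.pos_of_ne_zero hn) (Int.natCast_dvd_natCast.1 hdvd)) (by lia)

end CoxeterMatrix

/-! ### Consequences for Coxeter groups: order of `s_i s_j`, exchange, Matsumoto. -/

namespace CoxeterSystem

variable {B : Type*} {M : CoxeterMatrix B} {W : Type*} [Group W] (cs : CoxeterSystem M W)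

/-- The order of `s_i s_j` is exactly `m(i,j)`. -/
theorem simple_mul_simple_pow_ne_one {i j : B} (hij : i ≠ j) {n : ℕ} (hn : n ≠ 0)
    (hlt : M i j = 0 ∨ n < M i j) : (cs.simple i * cs.simple j) ^ n ≠ 1 := by
  intro h
  apply M.simpleReflection_mul_pow_ne_one hij hn hlt
  have := congrArg (cs.lift ⟨_, M.simpleReflection_isLiftable⟩) h
  simpa only [map_pow, map_mul, lift_apply_simple, map_one] using this

/-! ### The exchange property -/

open Classical in
/-- The action of a simple generator on pairs of an element of `W` and a sign. -/
noncomputable def signedConj (i : B) : Function.End (W × ZMod 2) := fun p =>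
  (cs.simple i * p.1 * cs.simple i, p.2 + if p.1 = cs.simple i then 1 else 0)

theorem end_mul_apply {α : Type*} (f g : Function.End α) (x : α) : (f * g) x = f (g x) :=
  rfl

open Classical in
theorem signedConj_mul_pow (i j : B) (n : ℕ) (p : W × ZMod 2) :
    ((cs.signedConj i * cs.signedConj j) ^ n) p =
      ((cs.simple i * cs.simple j) ^ n * p.1 * ((cs.simple i * cs.simple j) ^ n)⁻¹,
        p.2 + ∑ k ∈ Finset.range (2 * n),
          if p.1 = (cs.simple j * cs.simple i) ^ k * cs.simple j then 1 else 0) := by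
  set g := cs.simple i * cs.simple j with hg
  have hg' : cs.simple j * cs.simple i = g⁻¹ := by simp [hg]
  have hconj : ∀ k : ℕ, cs.simple j * g ^ k = (g⁻¹) ^ k * cs.simple j := by
    intro k
    induction k with
    | zero => simp
    | succ k ih =>
      rw [pow_succ, ← mul_assoc, ih, pow_succ, mul_assoc, mul_assoc, hg]
      simp [mul_assoc]
  induction n with
  | zero => simp; rfl
  | succ n ih =>
    rw [pow_succ', end_mul_apply, ih, end_mul_apply]
    have h₁ : g ^ n * p.1 * (g ^ n)⁻¹ = cs.simple j ↔ p.1 = (g⁻¹) ^ (2 * n) * cs.simple j := by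
      rw [mul_inv_eq_iff_eq_mul, ← eq_inv_mul_iff_mul_eq, hconj, ← mul_assoc, ← inv_pow, ← pow_add,
        two_mul]
    have h₂ : cs.simple j * (g ^ n * p.1 * (g ^ n)⁻¹) * cs.simple j = cs.simple i ↔
        p.1 = (g⁻¹) ^ (2 * n + 1) * cs.simple j := by
      have e : cs.simple j * (g ^ n * p.1 * (g ^ n)⁻¹) * cs.simple j = cs.simple i ↔
          g ^ n * p.1 * (g ^ n)⁻¹ = cs.simple j * cs.simple i * cs.simple j := by
        constructor
        · intro h
          rw [← h]
          simp [mul_assoc]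
        · intro h
          rw [h]
          simp [mul_assoc]
      rw [e, hg', mul_inv_eq_iff_eq_mul, ← eq_inv_mul_iff_mul_eq, mul_assoc g⁻¹, hconj, ← mul_assoc,
        ← mul_assoc, ← inv_pow, ← pow_succ, ← pow_add]
      congr! 3
      ring
    rw [show 2 * (n + 1) = 2 * n + 1 + 1 by ring, Finset.sum_range_succ, Finset.sum_range_succ]
    rw [hg']
    simp only [signedConj]
    simp only [h₁, h₂]
    ext1
    · simp [hg, pow_succ', mul_assoc]
    · simp only [add_assoc]

/-- The reflections `(s_j s_i)^k s_j`, `k < 2m`, have period `m` in `k`, so each is met an even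
number of times and the sign is unchanged. -/
theorem signedConj_isLiftable : M.IsLiftable cs.signedConj := by
  classical
  intro i j
  funext p
  rw [signedConj_mul_pow, simple_mul_simple_pow, two_mul, Finset.sum_range_add]
  have : ∀ k, (cs.simple j * cs.simple i) ^ (M i j + k) = (cs.simple j * cs.simple i) ^ k := by
    intro k
    rw [pow_add, simple_mul_simple_pow', one_mul]
  simp only [this]
  rw [CharTwo.add_self_eq_zero]
  simp
  rfl

open Classical in
theorem lift_signedConj_wordProd (ω : List B) (p : W × ZMod 2) :
    cs.lift ⟨_, cs.signedConj_isLiftable⟩ (cs.wordProd ω) p =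
      (cs.wordProd ω * p.1 * (cs.wordProd ω)⁻¹, p.2 + ((cs.rightInvSeq ω).count p.1 : ZMod 2)) := by
  induction ω with
  | nil => simp; rfl
  | cons i ω ih =>
    rw [wordProd_cons, map_mul, lift_apply_simple, end_mul_apply, ih]
    have h : cs.wordProd ω * p.1 * (cs.wordProd ω)⁻¹ = cs.simple i ↔
        (cs.wordProd ω)⁻¹ * cs.simple i * cs.wordProd ω = p.1 := by
      constructor
      · intro h
        rw [← h]
        group
      · intro h
        rw [← h]
        group
    simp only [signedConj, rightInvSeq, List.count_cons, h, beq_iff_eq]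
    ext1
    · simp [mul_assoc]
    · push_cast
      simp only [add_assoc]

open Classical in
/-- The parity of the number of occurrences of `t` in the inversion sequence of a word depends only
on the product of the word. -/
theorem count_rightInvSeq_eq {ω ω' : List B} (h : cs.wordProd ω = cs.wordProd ω') (t : W) :
    ((cs.rightInvSeq ω).count t : ZMod 2) = ((cs.rightInvSeq ω').count t : ZMod 2) := by
  have h₁ := cs.lift_signedConj_wordProd ω (t, 0)
  rw [h, lift_signedConj_wordProd] at h₁
  simpa using (congrArg Prod.snd h₁).symm

/-- The element also has a reduced word ending in `i`. There `s_i` occurs exactly once as an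
inversion, so by parity it occurs in the sequence of `ω`. -/
theorem mem_rightInvSeq_of_isRightDescent {ω : List B} {i : B}
    (h : cs.IsRightDescent (cs.wordProd ω) i) : cs.simple i ∈ cs.rightInvSeq ω := by
  classical
  obtain ⟨ω', hω', hw⟩ := cs.exists_isReduced (cs.wordProd ω * cs.simple i)
  have hprod : cs.wordProd (ω'.concat i) = cs.wordProd ω := by
    rw [wordProd_concat, ← hw, simple_mul_simple_cancel_right]
  have hred : cs.IsReduced (ω'.concat i) := by
    have h₁ := cs.isRightDescent_iff.1 h
    rw [IsReduced, hprod, ← h₁, hw, hω'.eq, List.length_concat]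
  have hc : (cs.rightInvSeq (ω'.concat i)).count (cs.simple i) = 1 := by
    apply List.count_eq_one_of_mem hred.nodup_rightInvSeq
    rw [rightInvSeq_concat]
    simp
  have := cs.count_rightInvSeq_eq hprod (cs.simple i)
  rw [hc] at this
  by_contra hmem
  rw [List.count_eq_zero_of_not_mem hmem] at this
  simp at this

/-- The exchange property. -/
theorem exists_eraseIdx_of_isRightDescent {ω : List B} {i : B}
    (h : cs.IsRightDescent (cs.wordProd ω) i) :
    ∃ k < ω.length, (cs.rightInvSeq ω).getD k 1 = cs.simple i ∧
      cs.wordProd ω * cs.simple i = cs.wordProd (ω.eraseIdx k) := by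
  obtain ⟨k, hk, hk'⟩ := List.mem_iff_getElem.1 (cs.mem_rightInvSeq_of_isRightDescent h)
  have hk₂ : (cs.rightInvSeq ω).getD k 1 = cs.simple i := by
    rw [List.getD_eq_getElem _ 1 hk, hk']
  exact ⟨k, by simpa using hk, hk₂, by rw [← hk₂, wordProd_mul_getD_rightInvSeq]⟩

/-- The exchange property for a concatenation: the letter is removed either from the second word,
in which case the generator is an inversion of this word, or from the first word. -/
theorem exchange_append {ω τ : List B} {i : B}
    (h : cs.IsRightDescent (cs.wordProd (ω ++ τ)) i) :
    (cs.simple i ∈ cs.rightInvSeq τ) ∨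
      ∃ ω' : List B, ω'.length + 1 = ω.length ∧
        cs.wordProd ω * cs.wordProd τ * cs.simple i = cs.wordProd ω' * cs.wordProd τ := by
  obtain ⟨k, hk, hk₁, hk₂⟩ := cs.exists_eraseIdx_of_isRightDescent h
  by_cases hlt : k < ω.length
  · right
    refine ⟨ω.eraseIdx k, List.length_eraseIdx_add_one hlt, ?_⟩
    rw [List.eraseIdx_append_of_lt_length hlt, wordProd_append, wordProd_append] at hk₂
    exact hk₂
  · left
    have hd : (ω ++ τ).drop ω.length = τ := List.drop_left
    rw [← hd, rightInvSeq_drop, List.mem_iff_getElem]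
    rw [List.length_append] at hk
    refine ⟨k - ω.length, by simp; lia, ?_⟩
    rw [List.getElem_drop, ← hk₁, List.getD_eq_getElem _ _ (by simp; lia)]
    congr 1
    lia

/-! ### Matsumoto's theorem -/

theorem mem_rightInvSeq_alternatingWord {i j : B} {k : ℕ} {t : W}
    (ht : t ∈ cs.rightInvSeq (alternatingWord i j k)) :
    ∃ a < k, t = cs.simple j * (cs.simple i * cs.simple j) ^ a := by
  induction k with
  | zero => simp [alternatingWord] at ht
  | succ k ih =>
    rw [alternatingWord_succ', rightInvSeq, List.mem_cons] at ht
    rcases ht with ht | ht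
    · refine ⟨k, k.lt_succ_self, ?_⟩
      rw [ht, prod_alternatingWord_eq_mul_pow]
      set g := cs.simple i * cs.simple j with hg
      have hconj : ∀ n : ℕ, (g ^ n)⁻¹ * cs.simple j = cs.simple j * g ^ n := by
        intro n
        induction n with
        | zero => simp
        | succ n ihn =>
          rw [pow_succ, mul_inv_rev, mul_assoc, ihn, ← mul_assoc, ← pow_succ, pow_succ', ← mul_assoc,
            hg]
          simp [mul_assoc]
      obtain ⟨p, rfl | rfl⟩ := Nat.even_or_odd' k
      · simp only [even_two, Even.mul_right, ↓reduceIte, one_mul]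
        rw [Nat.mul_div_cancel_left p two_pos, hconj, mul_assoc, ← pow_add, two_mul]
      · have : ¬ Even (2 * p + 1) := by simp
        have h2 : (2 * p + 1) / 2 = p := by lia
        simp only [this, ↓reduceIte, h2]
        rw [mul_inv_rev, inv_simple, hconj, mul_assoc, ← mul_assoc (cs.simple i), ← hg, mul_assoc,
          ← pow_succ', ← pow_add]
        congr 2
        ring
    · obtain ⟨a, ha, h⟩ := ih ht
      exact ⟨a, ha.trans k.lt_succ_self, h⟩

/-- Otherwise `s_i = s_j (s_i s_j)^a` with `a < k`, so `(s_i s_j)^(a+1) = 1` with `a + 1` below the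
order. -/
theorem simple_notMem_rightInvSeq_alternatingWord {i j : B} (hij : i ≠ j) {k : ℕ}
    (hk : M i j = 0 ∨ k < M i j) :
    cs.simple i ∉ cs.rightInvSeq (alternatingWord i j k) := by
  intro h
  obtain ⟨a, ha, hia⟩ := cs.mem_rightInvSeq_alternatingWord h
  refine cs.simple_mul_simple_pow_ne_one hij a.succ_ne_zero (hk.imp_right fun h => by lia) ?_
  rw [pow_succ', mul_assoc, ← hia, simple_mul_simple_self]

/-- An element with the right descents `i ≠ j` has a reduced word that ends with an alternating
word of any length up to `m(i,j)`. -/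
theorem exists_append_alternatingWord {w : W} (k : ℕ) {i j : B} (hij : i ≠ j)
    (hi : cs.IsRightDescent w i) (hj : cs.IsRightDescent w j) (hk : M i j = 0 ∨ k ≤ M i j) :
    ∃ ω : List B, cs.IsReduced (ω ++ alternatingWord i j k) ∧
      cs.wordProd (ω ++ alternatingWord i j k) = w := by
  induction k generalizing i j with
  | zero =>
    obtain ⟨ω, hω, hw⟩ := cs.exists_isReduced w
    exact ⟨ω, by simpa [alternatingWord] using hω, by simpa [alternatingWord] using hw.symm⟩
  | succ k ih =>
    -- The roles of `i` and `j` alternate. The exchange for the descent `j` cannot remove a letter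
    -- of the alternating tail, so it shortens `ω`; appending `j` then lengthens the tail.
    obtain ⟨ω, hω, hw⟩ := ih hij.symm hj hi
      (by rw [M.symmetric j i]; exact hk.imp_right fun h => by lia)
    have hj' := hj
    rw [← hw] at hj'
    rcases cs.exchange_append hj' with h | ⟨ω', hlen, hω'⟩
    · refine absurd h (cs.simple_notMem_rightInvSeq_alternatingWord hij.symm ?_)
      rw [M.symmetric j i]
      exact hk.imp_right fun h => by lia
    · have hprod : cs.wordProd (ω' ++ alternatingWord i j (k + 1)) = w := by
        rw [alternatingWord_succ, wordProd_append, wordProd_concat, ← mul_assoc, ← hω',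
          simple_mul_simple_cancel_right, ← wordProd_append, hw]
      refine ⟨ω', ?_, hprod⟩
      rw [IsReduced, hprod, ← hw, hω.eq]
      simp only [List.length_append, length_alternatingWord]
      lia

theorem IsReduced.of_append_left {ω τ : List B} (h : cs.IsReduced (ω ++ τ)) : cs.IsReduced ω := by
  have := h.take ω.length
  rwa [List.take_left] at this

theorem isRightDescent_of_isReduced_concat {ω : List B} {i : B} (h : cs.IsReduced (ω ++ [i])) :
    cs.IsRightDescent (cs.wordProd (ω ++ [i])) i := by
  have hω := IsReduced.of_append_left cs h
  rw [IsRightDescent, h.eq, wordProd_append, wordProd_singleton, simple_mul_simple_cancel_right,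
    hω.eq]
  simp

/-- Matsumoto's theorem: the value of a map on reduced words of an element of `W` is independent of
the reduced word as soon as the map is multiplicative and respects the braid relations. -/
theorem prod_map_eq_of_isReduced {G : Type*} [Monoid G] (f : B → G)
    (hf : ∀ i j, ((alternatingWord i j (M i j)).map f).prod =
      ((alternatingWord j i (M i j)).map f).prod)
    {ω ω' : List B} (hω : cs.IsReduced ω) (hω' : cs.IsReduced ω')
    (h : cs.wordProd ω = cs.wordProd ω') : (ω.map f).prod = (ω'.map f).prod := by
  obtain ⟨n, hn⟩ : ∃ n, ω.length = n := ⟨_, rfl⟩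
  induction n generalizing ω ω' with
  | zero =>
    have hn' : ω'.length = 0 := by rw [← hω'.eq, ← h, hω.eq, hn]
    rw [List.length_eq_zero_iff] at hn hn'
    rw [hn, hn']
  | succ n ih =>
    have key : ∀ {ω ω' : List B} {i : B}, cs.IsReduced (ω ++ [i]) → cs.IsReduced (ω' ++ [i]) →
        cs.wordProd (ω ++ [i]) = cs.wordProd (ω' ++ [i]) → (ω ++ [i]).length = n + 1 →
        ((ω ++ [i]).map f).prod = ((ω' ++ [i]).map f).prod := by
      intro ω ω' i h₁ h₂ h₃ h₄
      rw [wordProd_append, wordProd_append, mul_left_inj] at h₃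
      rw [List.map_append, List.map_append, List.prod_append, List.prod_append,
        ih (IsReduced.of_append_left cs h₁) (IsReduced.of_append_left cs h₂) h₃
          (by simpa using h₄)]
    have hn' : ω'.length = n + 1 := by rw [← hω'.eq, ← h, hω.eq, hn]
    obtain ⟨ω, i, rfl⟩ := List.eq_nil_or_concat' ω |>.resolve_left (by rintro rfl; simp at hn)
    obtain ⟨ω', j, rfl⟩ := List.eq_nil_or_concat' ω' |>.resolve_left (by rintro rfl; simp at hn')
    by_cases hij : i = j
    · subst hij
      exact key hω hω' h hn
    have hi := cs.isRightDescent_of_isReduced_concat hω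
    have hj := cs.isRightDescent_of_isReduced_concat hω'
    rw [← h] at hj
    -- If `m(i,j) = ∞`, alternating tails could be longer than the word itself.
    have hm : M i j ≠ 0 := by
      intro hm
      obtain ⟨τ, hτ, hτw⟩ := cs.exists_append_alternatingWord (n + 2) hij hi hj (Or.inl hm)
      have : cs.length (cs.wordProd (ω ++ [i])) = n + 1 := by rw [hω.eq, hn]
      rw [← hτw, hτ.eq, List.length_append, length_alternatingWord] at this
      lia
    obtain ⟨m, hm'⟩ := Nat.exists_eq_succ_of_ne_zero hm
    obtain ⟨τ, hτ, hτw⟩ := cs.exists_append_alternatingWord (M i j) hij hi hj (Or.inr le_rfl)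
    have hbraid : cs.wordProd (τ ++ alternatingWord j i (M i j)) = cs.wordProd (ω ++ [i]) := by
      rw [← hτw, wordProd_append, wordProd_append, cs.wordProd_braidWord_eq i j]
      simp only [braidWord, M.symmetric j i]
    have hτ' : cs.IsReduced (τ ++ alternatingWord j i (M i j)) := by
      rw [IsReduced, hbraid, ← hτw, hτ.eq]
      simp
    -- The two alternating words end in `i` and in `j`. Each given word is compared with the one
    -- sharing its last letter, and the braid relation links the two.
    have split : ∀ a b : B, τ ++ alternatingWord a b (M i j) =
        (τ ++ alternatingWord b a m) ++ [b] := by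
      intro a b
      rw [hm', Nat.succ_eq_add_one, alternatingWord_succ, List.concat_eq_append, List.append_assoc]
    have e₁ : ((ω ++ [i]).map f).prod = ((τ ++ alternatingWord j i (M i j)).map f).prod := by
      rw [split]
      rw [split] at hτ' hbraid
      exact key hω hτ' hbraid.symm hn
    have e₂ : ((ω' ++ [j]).map f).prod = ((τ ++ alternatingWord i j (M i j)).map f).prod := by
      rw [split]
      rw [split] at hτ hτw
      exact key hω' hτ (by rw [hτw, h]) hn'
    rw [e₁, e₂, List.map_append, List.map_append, List.prod_append, List.prod_append, hf i j]

end CoxeterSystem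

namespace Salvetti

variable {N : ℕ} {Γ : CoxeterMatrix (Fin N)} {W : Type u} [Group W] (cs : CoxeterSystem Γ W)

/-! ### Parabolic subgroups -/

theorem parabolic_mono {T U : Finset (Fin N)} (h : T ⊆ U) : parabolic cs T ≤ parabolic cs U :=
  Subgroup.closure_mono (Set.image_mono (Finset.coe_subset.2 h))

theorem simple_mem_parabolic {T : Finset (Fin N)} {i : Fin N} (h : i ∈ T) :
    cs.simple i ∈ parabolic cs T :=
  Subgroup.subset_closure ⟨i, h, rfl⟩

theorem wordProd_mem_parabolic {T : Finset (Fin N)} {τ : List (Fin N)} (h : ∀ i ∈ τ, i ∈ T) :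
    cs.wordProd τ ∈ parabolic cs T := by
  refine Subgroup.list_prod_mem _ fun x hx => ?_
  obtain ⟨i, hi, rfl⟩ := List.mem_map.1 hx
  exact simple_mem_parabolic cs (h i hi)

theorem exists_word_of_mem_parabolic {T : Finset (Fin N)} {v : W} (hv : v ∈ parabolic cs T) :
    ∃ τ : List (Fin N), (∀ i ∈ τ, i ∈ T) ∧ cs.wordProd τ = v := by
  induction hv using Subgroup.closure_induction with
  | mem x hx =>
    obtain ⟨i, hi, rfl⟩ := hx
    exact ⟨[i], by simpa using hi, by simp⟩
  | one => exact ⟨[], by simp, by simp⟩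
  | mul x y _ _ hx hy =>
    obtain ⟨σ, hσ, rfl⟩ := hx
    obtain ⟨τ, hτ, rfl⟩ := hy
    refine ⟨σ ++ τ, fun i hi => ?_, cs.wordProd_append σ τ⟩
    exact (List.mem_append.1 hi).elim (hσ i) (hτ i)
  | inv x _ hx =>
    obtain ⟨σ, hσ, rfl⟩ := hx
    exact ⟨σ.reverse, fun i hi => hσ i (List.mem_reverse.1 hi), cs.wordProd_reverse σ⟩

theorem exists_isReduced_subset (τ : List (Fin N)) :
    ∃ τ' : List (Fin N), τ' ⊆ τ ∧ cs.IsReduced τ' ∧ cs.wordProd τ' = cs.wordProd τ := by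
  induction τ using List.reverseRecOn with
  | nil => exact ⟨[], List.Subset.refl _, by simp [CoxeterSystem.IsReduced], rfl⟩
  | append_singleton τ i ih =>
    obtain ⟨τ', hsub, hred, hprod⟩ := ih
    by_cases hd : cs.IsRightDescent (cs.wordProd τ') i
    · obtain ⟨k, hk, -, hk'⟩ := cs.exists_eraseIdx_of_isRightDescent hd
      have hp : cs.wordProd (τ'.eraseIdx k) = cs.wordProd (τ ++ [i]) := by
        rw [← hk', hprod, cs.wordProd_append, cs.wordProd_singleton]
      refine ⟨τ'.eraseIdx k, fun x hx => ?_, ?_, hp⟩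
      · exact List.mem_append_left _ (hsub (List.mem_of_mem_eraseIdx hx))
      · have h₁ := cs.isRightDescent_iff.1 hd
        rw [hk', hred.eq, ← List.length_eraseIdx_add_one hk] at h₁
        exact Nat.succ_injective h₁
    · have hp : cs.wordProd (τ' ++ [i]) = cs.wordProd τ' * cs.simple i := by
        rw [cs.wordProd_append, cs.wordProd_singleton]
      refine ⟨τ' ++ [i], ?_, ?_, ?_⟩
      · exact List.append_subset.2 ⟨fun x hx => List.mem_append_left _ (hsub hx), by simp⟩
      · rw [CoxeterSystem.IsReduced, hp, cs.not_isRightDescent_iff.1 hd, hred.eq]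
        simp
      · rw [hp, hprod, cs.wordProd_append, cs.wordProd_singleton]

theorem exists_isReduced_of_mem_parabolic {T : Finset (Fin N)} {v : W} (hv : v ∈ parabolic cs T) :
    ∃ τ : List (Fin N), (∀ i ∈ τ, i ∈ T) ∧ cs.IsReduced τ ∧ cs.wordProd τ = v := by
  obtain ⟨τ, hτ, rfl⟩ := exists_word_of_mem_parabolic cs hv
  obtain ⟨τ', hsub, hred, hprod⟩ := exists_isReduced_subset cs τ
  exact ⟨τ', fun i hi => hτ i (hsub hi), hred, hprod⟩

/-- If a new letter `i` shortened the product, the exchange would either make `s_i` a right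
inversion of `τ`, against `τ i` being reduced, or shorten `ω` within its coset modulo `W_T`, against
minimality. -/
theorem isReduced_append_of_forall_length_le {T : Finset (Fin N)} {ω : List (Fin N)}
    (hω : cs.IsReduced ω)
    (hmin : ∀ v ∈ parabolic cs T, cs.length (cs.wordProd ω) ≤ cs.length (cs.wordProd ω * v))
    {τ : List (Fin N)} (hT : ∀ i ∈ τ, i ∈ T) (hτ : cs.IsReduced τ) : cs.IsReduced (ω ++ τ) := by
  induction τ using List.reverseRecOn with
  | nil => simpa using hω
  | append_singleton τ i ih =>
    have hT' : ∀ i ∈ τ, i ∈ T := fun j hj => hT j (List.mem_append_left _ hj)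
    have hτ' := CoxeterSystem.IsReduced.of_append_left cs hτ
    have hred := ih hT' hτ'
    by_cases hd : cs.IsRightDescent (cs.wordProd (ω ++ τ)) i
    · exfalso
      rcases cs.exchange_append hd with h | ⟨ω', hlen, hω'⟩
      · have h₁ := (cs.isRightInversion_of_mem_rightInvSeq hτ' h).2
        rw [← cs.wordProd_singleton, ← cs.wordProd_append, hτ.eq, hτ'.eq, List.length_append] at h₁
        lia
      · have hv : cs.wordProd τ * cs.simple i * (cs.wordProd τ)⁻¹ ∈ parabolic cs T :=
          mul_mem (mul_mem (wordProd_mem_parabolic cs hT')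
            (simple_mem_parabolic cs (hT i (by simp)))) (inv_mem (wordProd_mem_parabolic cs hT'))
        have h₁ := hmin _ hv
        rw [← mul_assoc, ← mul_assoc, hω', mul_inv_cancel_right, hω.eq] at h₁
        have := cs.length_wordProd_le ω'
        lia
    · rw [CoxeterSystem.IsReduced, ← List.append_assoc, cs.wordProd_append (ω ++ τ),
        cs.wordProd_singleton, cs.not_isRightDescent_iff.1 hd, hred.eq]
      simp [add_assoc]

/-- If `x` has minimal length in `x W_T`, then `l(x v) = l(x) + l(v)` for all `v ∈ W_T`. -/
theorem length_mul_of_forall_length_le {T : Finset (Fin N)} {x : W}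
    (hx : ∀ v ∈ parabolic cs T, cs.length x ≤ cs.length (x * v)) {v : W}
    (hv : v ∈ parabolic cs T) : cs.length (x * v) = cs.length x + cs.length v := by
  obtain ⟨ω, hω, rfl⟩ := cs.exists_isReduced x
  obtain ⟨τ, hT, hτ, rfl⟩ := exists_isReduced_of_mem_parabolic cs hv
  rw [← cs.wordProd_append, (isReduced_append_of_forall_length_le cs hω hx hT hτ).eq, hω.eq, hτ.eq,
    List.length_append]

/-- Two minimal representatives of one coset differ by some `v ∈ W_T`; additivity of length in both
directions gives `l(v) = 0`. -/
theorem minReps_mul_injOn (U T : Finset (Fin N)) :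
    Set.InjOn (fun p : W × W => p.1 * p.2) (minReps cs U T ×ˢ (parabolic cs T : Set W)) := by
  rintro ⟨x, y⟩ ⟨hx, hy⟩ ⟨x', y'⟩ ⟨hx', hy'⟩ h
  have hy : y ∈ parabolic cs T := hy
  have hy' : y' ∈ parabolic cs T := hy'
  have h : x * y = x' * y' := h
  have h₁ : x' = x * (y * y'⁻¹) := by rw [← mul_assoc, h, mul_inv_cancel_right]
  have h₂ : x = x' * (y * y'⁻¹)⁻¹ := by rw [h₁, mul_inv_cancel_right]
  have hv : y * y'⁻¹ ∈ parabolic cs T := mul_mem hy (inv_mem hy')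
  have l₁ := length_mul_of_forall_length_le cs hx.2 hv
  have l₂ := length_mul_of_forall_length_le cs hx'.2 (inv_mem hv)
  rw [← h₁] at l₁
  rw [← h₂] at l₂
  have hone : y * y'⁻¹ = 1 := cs.length_eq_zero_iff.1 (by lia)
  rw [hone, mul_one] at h₁
  exact Prod.ext h₁.symm (mul_inv_eq_one.1 hone)

theorem mul_mem_minReps {U T' T : Finset (Fin N)} (hU : T' ⊆ U) (hT : T ⊆ T') {x y : W}
    (hx : x ∈ minReps cs U T') (hy : y ∈ minReps cs T' T) : x * y ∈ minReps cs U T := by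
  refine ⟨mul_mem hx.1 (parabolic_mono cs hU hy.1), fun v hv => ?_⟩
  rw [mul_assoc, length_mul_of_forall_length_le cs hx.2 hy.1,
    length_mul_of_forall_length_le cs hx.2 (mul_mem hy.1 (parabolic_mono cs hT hv))]
  exact Nat.add_le_add_left (hy.2 v hv) _

/-- Take `x = z u` shortest in `z W_{T'}` and `y = u⁻¹`. Length is additive over `x`, so minimality
of `z` modulo `W_T` passes to `y`. -/
theorem exists_mul_eq_of_mem_minReps {U T' T : Finset (Fin N)} (hU : T' ⊆ U) (hT : T ⊆ T') {z : W}
    (hz : z ∈ minReps cs U T) : ∃ x ∈ minReps cs U T', ∃ y ∈ minReps cs T' T, x * y = z := by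
  obtain ⟨u, hu, hmin⟩ : ∃ u ∈ parabolic cs T', ∀ v ∈ parabolic cs T',
      cs.length (z * u) ≤ cs.length (z * v) := by
    obtain ⟨u, hu, h⟩ := (InvImage.wf (fun u => cs.length (z * u)) Nat.lt_wfRel.wf).has_min
      (parabolic cs T' : Set W) ⟨1, one_mem _⟩
    exact ⟨u, hu, fun v hv => not_lt.1 (h v hv)⟩
  have hx : ∀ v ∈ parabolic cs T', cs.length (z * u) ≤ cs.length (z * u * v) := fun v hv => by
    rw [mul_assoc]
    exact hmin _ (mul_mem hu hv)
  refine ⟨z * u, ⟨mul_mem hz.1 (parabolic_mono cs hU hu), hx⟩, u⁻¹, ⟨inv_mem hu, fun v hv => ?_⟩,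
    mul_inv_cancel_right z u⟩
  have h₁ := length_mul_of_forall_length_le cs hx (inv_mem hu)
  have h₂ := length_mul_of_forall_length_le cs hx (mul_mem (inv_mem hu) (parabolic_mono cs hT hv))
  rw [mul_inv_cancel_right] at h₁
  rw [← mul_assoc, mul_inv_cancel_right] at h₂
  have := hz.2 v hv
  lia

theorem minReps_finite {U : Finset (Fin N)} (hU : Finite (parabolic cs U)) (T : Finset (Fin N)) :
    (minReps cs U T).Finite :=
  (Set.toFinite (parabolic cs U : Set W)).subset fun _ h => h.1

/-! ### The section of the Artin group -/

theorem artinGroup_braid (i j : Fin N) :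
    ((CoxeterSystem.alternatingWord i j (Γ i j)).map
        fun s => (PresentedGroup.of s : ArtinGroup Γ)).prod =
      ((CoxeterSystem.alternatingWord j i (Γ i j)).map
        fun s => (PresentedGroup.of s : ArtinGroup Γ)).prod := by
  have key : ∀ ω : List (Fin N), (ω.map fun s => (PresentedGroup.of s : ArtinGroup Γ)).prod =
      PresentedGroup.mk _ (ω.map FreeGroup.of).prod := by
    intro ω
    rw [map_list_prod, List.map_map]
    rfl
  rw [key, key, ← mul_inv_eq_one, ← map_inv, ← map_mul]
  exact PresentedGroup.one_of_mem ⟨(i, j), rfl⟩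

theorem lift_wordProd {ω : List (Fin N)} (hω : cs.IsReduced ω) :
    lift cs (cs.wordProd ω) = (ω.map fun s => (PresentedGroup.of s : ArtinGroup Γ)).prod := by
  have h := (cs.exists_isReduced (cs.wordProd ω)).choose_spec
  exact cs.prod_map_eq_of_isReduced _ artinGroup_braid h.1 hω h.2.symm

/-- `ψ` is not a homomorphism; when lengths add, reduced words concatenate to a reduced word, and
Matsumoto's theorem applies. -/
theorem lift_mul {x y : W} (h : cs.length (x * y) = cs.length x + cs.length y) :
    lift cs (x * y) = lift cs x * lift cs y := by
  obtain ⟨ω, hω, rfl⟩ := cs.exists_isReduced x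
  obtain ⟨τ, hτ, rfl⟩ := cs.exists_isReduced y
  rw [← cs.wordProd_append] at h ⊢
  have hred : cs.IsReduced (ω ++ τ) := by
    rw [CoxeterSystem.IsReduced, h, hω.eq, hτ.eq, List.length_append]
  rw [lift_wordProd cs hred, lift_wordProd cs hω, lift_wordProd cs hτ, List.map_append,
    List.prod_append]

/-! ### The coboundary -/

variable {R : Type w} [CommRing R] {M : Type v} [AddCommGroup M] [Module R M]
  (ρ : ArtinGroup Γ →* (M ≃ₗ[R] M))

/-- Multiplication is a bijection between pairs of minimal representatives and the minimal
representatives for `T ⊆ U`; signs and values of `ψ` multiply because lengths add. Finiteness of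
`W_U` turns the `finsum`s into genuine sums. -/
theorem cosetSum_comp {U T' T : Finset (Fin N)} (hfin : Finite (parabolic cs U)) (hU : T' ⊆ U)
    (hT : T ⊆ T') : cosetSum cs ρ U T' ∘ₗ cosetSum cs ρ T' T = cosetSum cs ρ U T := by
  have hfin' : Finite (parabolic cs T') :=
    Finite.of_injective _ (Subgroup.inclusion_injective (parabolic_mono cs hU))
  rw [cosetSum, cosetSum, cosetSum,
    finsum_mem_eq_finite_toFinset_sum _ (minReps_finite cs hfin T'),
    finsum_mem_eq_finite_toFinset_sum _ (minReps_finite cs hfin' T),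
    finsum_mem_eq_finite_toFinset_sum _ (minReps_finite cs hfin T),
    ← Module.End.mul_eq_comp, Finset.sum_mul_sum, ← Finset.sum_product']
  refine Finset.sum_nbij (fun p => p.1 * p.2) ?_ ?_ ?_ ?_
  · rintro ⟨x, y⟩ h
    simp only [Finset.mem_product, Set.Finite.mem_toFinset] at h ⊢
    exact mul_mem_minReps cs hU hT h.1 h.2
  · refine (minReps_mul_injOn cs U T').mono ?_
    rintro ⟨x, y⟩ h
    simp only [Finset.coe_product, Set.Finite.coe_toFinset] at h
    exact ⟨h.1, h.2.1⟩
  · intro z hz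
    simp only [Set.Finite.coe_toFinset] at hz
    obtain ⟨x, hx, y, hy, rfl⟩ := exists_mul_eq_of_mem_minReps cs hU hT hz
    exact ⟨(x, y), by simpa using ⟨hx, hy⟩, rfl⟩
  · rintro ⟨x, y⟩ h
    simp only [Finset.mem_product, Set.Finite.mem_toFinset] at h
    have hl := length_mul_of_forall_length_le cs h.1.2 h.2.1
    rw [lift_mul cs hl, hl, map_mul, pow_add, smul_mul_smul_comm]
    rfl

open Classical in
/-- The cochain `b.e_U`, which is zero if `U` does not index a cell of dimension `n`. -/
noncomputable def cellCochain (n : ℤ) (U : Finset (Fin N)) : M →ₗ[R] Cochain cs ρ n :=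
  if h : (U.card : ℤ) = n ∧ Finite (parabolic cs U) then
    Finsupp.lsingle (⟨U, h⟩ : Cell cs n)
  else 0

theorem cellCochain_coe {n : ℤ} (T : Cell cs n) (a : M) :
    cellCochain cs ρ n T.1 a = Finsupp.single T a := by
  rw [cellCochain, dif_pos T.2]
  rfl

theorem cellCochain_of_not {n : ℤ} {U : Finset (Fin N)}
    (h : ¬((U.card : ℤ) = n ∧ Finite (parabolic cs U))) (a : M) :
    cellCochain cs ρ n U a = 0 := by
  rw [cellCochain, dif_neg h]
  rfl

/-- With `e_U = 0` for infinite `W_U` the finiteness conditions disappear from `δ`. This is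
consistent because `W_T ≤ W_{T ∪ {s}}`: an infinite `W_T` makes every term zero. -/
theorem delta_cellCochain (n : ℤ) (T : Finset (Fin N)) (a : M) :
    delta cs ρ n (cellCochain cs ρ n T a) =
      ∑ s : Fin N, if s ∉ T then
        (-1 : ℤ) ^ (sigma s T + 1) •
          cellCochain cs ρ (n + 1) (insert s T) (cosetSum cs ρ (insert s T) T a)
      else 0 := by
  by_cases hT : (T.card : ℤ) = n ∧ Finite (parabolic cs T)
  · rw [cellCochain_coe cs ρ ⟨T, hT⟩, delta, Finsupp.lsum_single, LinearMap.sum_apply]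
    refine Finset.sum_congr rfl fun s _ => ?_
    by_cases hs : s ∈ T
    · rw [dif_neg (by tauto), if_neg (by tauto)]
      rfl
    · rw [if_pos hs]
      by_cases hf : Finite (parabolic cs (insert s T))
      · have hc : ((insert s T).card : ℤ) = n + 1 := by
          rw [Finset.card_insert_of_notMem hs]
          push_cast
          rw [hT.1]
        rw [dif_pos ⟨hs, hf⟩, cellCochain_coe cs ρ ⟨insert s T, hc, hf⟩]
        rfl
      · rw [dif_neg (by tauto), cellCochain_of_not cs ρ (by tauto), smul_zero]
        rfl
  · rw [cellCochain_of_not cs ρ hT, map_zero]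
    refine (Finset.sum_eq_zero fun s _ => ?_).symm
    split_ifs with hs
    · rfl
    · rw [cellCochain_of_not cs ρ, smul_zero]
      rintro ⟨hc, hf⟩
      refine hT ⟨?_, Finite.of_injective _ (Subgroup.inclusion_injective
        (parabolic_mono cs (Finset.subset_insert s T)))⟩
      rw [Finset.card_insert_of_notMem hs] at hc
      push_cast at hc
      lia

theorem cellCochain_cosetSum_cosetSum (n : ℤ) {U T' T : Finset (Fin N)} (hU : T' ⊆ U)
    (hT : T ⊆ T') (a : M) :
    cellCochain cs ρ n U (cosetSum cs ρ U T' (cosetSum cs ρ T' T a)) =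
      cellCochain cs ρ n U (cosetSum cs ρ U T a) := by
  by_cases h : (U.card : ℤ) = n ∧ Finite (parabolic cs U)
  · rw [← cosetSum_comp cs ρ h.2 hU hT, LinearMap.comp_apply]
  · rw [cellCochain_of_not cs ρ h, cellCochain_of_not cs ρ h]

theorem sigma_insert {s : Fin N} {T : Finset (Fin N)} (hs : s ∉ T) (t : Fin N) :
    sigma t (insert s T) = sigma t T + if s < t then 1 else 0 := by
  rw [sigma, sigma, Finset.filter_insert]
  split_ifs with h
  · rw [Finset.card_insert_of_notMem fun h' => hs (Finset.mem_filter.1 h').1]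
  · rfl

/-- The double sum runs over ordered pairs `(s, t)` and is cancelled by the swap. For `s < t`,
inserting `s` raises `σ(t, ·)` by one, while inserting `t` leaves `σ(s, ·)` unchanged. -/
theorem delta_comp_delta (n : ℤ) : delta cs ρ (n + 1) ∘ₗ delta cs ρ n = 0 := by
  refine Finsupp.lhom_ext fun T a => ?_
  rw [LinearMap.comp_apply, ← cellCochain_coe cs ρ, delta_cellCochain, map_sum, LinearMap.zero_apply]
  obtain ⟨T, -⟩ := T
  dsimp only
  let F : Fin N × Fin N → Cochain cs ρ (n + 1 + 1) := fun p =>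
    if p.1 ∉ T ∧ p.2 ∉ T ∧ p.1 ≠ p.2 then
      (-1 : ℤ) ^ (sigma p.1 T + 1 + (sigma p.2 (insert p.1 T) + 1)) •
        cellCochain cs ρ (n + 1 + 1) (insert p.2 (insert p.1 T))
          (cosetSum cs ρ (insert p.2 (insert p.1 T)) T a)
    else 0
  have hF : ∀ s : Fin N, delta cs ρ (n + 1) (if s ∉ T then (-1 : ℤ) ^ (sigma s T + 1) •
      cellCochain cs ρ (n + 1) (insert s T) (cosetSum cs ρ (insert s T) T a) else 0) =
        ∑ t, F (s, t) := by
    intro s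
    by_cases hs : s ∈ T
    · simp [hs, F]
    rw [if_pos hs, map_zsmul, delta_cellCochain, Finset.smul_sum]
    refine Finset.sum_congr rfl fun t _ => ?_
    by_cases ht : t ∈ insert s T
    · have : ¬(s ∉ T ∧ t ∉ T ∧ s ≠ t) := by
        rw [Finset.mem_insert] at ht
        tauto
      simp only [F, if_neg this]
      rw [if_neg (not_not.2 ht), smul_zero]
    · have : s ∉ T ∧ t ∉ T ∧ s ≠ t := by
        rw [Finset.mem_insert] at ht
        tauto
      simp only [F, if_pos this]
      rw [if_pos ht, cellCochain_cosetSum_cosetSum cs ρ _ (Finset.subset_insert _ _)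
        (Finset.subset_insert _ _), smul_smul, ← pow_add]
  rw [Finset.sum_congr rfl fun s _ => hF s, ← Finset.sum_product', Finset.univ_product_univ]
  have hanti : ∀ s t : Fin N, s < t → F (s, t) + F (t, s) = 0 := by
    intro s t hst
    by_cases h : s ∉ T ∧ t ∉ T ∧ s ≠ t
    · have h' : t ∉ T ∧ s ∉ T ∧ t ≠ s := ⟨h.2.1, h.1, h.2.2.symm⟩
      simp only [F, if_pos h, if_pos h', Finset.insert_comm s t T, sigma_insert h.1 t,
        sigma_insert h.2.1 s, if_pos hst, if_neg hst.not_gt]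
      rw [← add_smul]
      convert! zero_smul ℤ _
      ring
    · have h' : ¬(t ∉ T ∧ s ∉ T ∧ t ≠ s) := fun h' => h ⟨h'.2.1, h'.1, h'.2.2.symm⟩
      simp only [F, if_neg h, if_neg h', add_zero]
  refine Finset.sum_involution (fun p _ => p.swap) ?_ ?_ (fun _ _ => Finset.mem_univ _)
    (fun _ _ => Prod.swap_swap _)
  · rintro ⟨s, t⟩ -
    rcases lt_trichotomy s t with h | h | h
    · exact hanti s t h
    · subst h
      simp [F]
    · exact (add_comm _ _).trans (hanti t s h)
  · rintro ⟨s, t⟩ - h heq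
    have : t = s := congrArg Prod.fst heq
    subst this
    simp [F] at h

/-! ### The filtration -/

theorem filtration_anti {k l : ℤ} (h : k ≤ l) (n : ℤ) :
    filtration cs ρ l n ≤ filtration cs ρ k n :=
  Finsupp.supported_mono fun _ hT => ⟨h.trans hT.1, fun t ht => hT.2 t (by lia)⟩

theorem delta_mem_filtration {k n : ℤ} {x : Cochain cs ρ n} (hx : x ∈ filtration cs ρ k n) :
    delta cs ρ n x ∈ filtration cs ρ k (n + 1) := by
  rw [← Finsupp.sum_single x, Finsupp.sum, map_sum]
  refine sum_mem fun T hT => ?_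
  have hT : k ≤ N ∧ ∀ t : Fin N, (N : ℤ) ≤ (t : ℤ) + k → t ∈ T.1 :=
    (Finsupp.mem_supported R x).1 hx hT
  rw [← cellCochain_coe cs ρ, delta_cellCochain]
  refine sum_mem fun s _ => ?_
  split_ifs with hs
  · exact zero_mem _
  · refine zsmul_mem ?_ _
    by_cases h : ((insert s T.1).card : ℤ) = n + 1 ∧ Finite (parabolic cs (insert s T.1))
    · rw [cellCochain_coe cs ρ ⟨_, h⟩]
      exact Finsupp.single_mem_supported R _
        ⟨hT.1, fun t ht => Finset.mem_insert_of_mem (hT.2 t ht)⟩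
    · rw [cellCochain_of_not cs ρ h]
      exact zero_mem _

theorem filtration_eq_top {k : ℤ} (hk : k ≤ 0) (n : ℤ) : filtration cs ρ k n = ⊤ := by
  have : {T : Cell cs n | k ≤ N ∧ ∀ t : Fin N, (N : ℤ) ≤ (t : ℤ) + k → t ∈ T.1} = Set.univ :=
    Set.eq_univ_of_forall fun T => ⟨by lia, fun t ht => absurd t.2 (by omega)⟩
  rw [filtration, this, Finsupp.supported_univ]

/-- The membership condition alone would stabilize at `k = N` to the full set of vertices; the
clause `k ≤ N` makes the later steps zero. -/
theorem filtration_eq_bot {k : ℤ} (hk : (N : ℤ) + 1 ≤ k) (n : ℤ) : filtration cs ρ k n = ⊥ := by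
  have : {T : Cell cs n | k ≤ N ∧ ∀ t : Fin N, (N : ℤ) ≤ (t : ℤ) + k → t ∈ T.1} = ∅ :=
    Set.eq_empty_of_forall_notMem fun T hT => by have := hT.1; lia
  rw [filtration, this, Finsupp.supported_empty]

theorem filtration_eq_bot_of_lt {k n : ℤ} (hk : n < k) : filtration cs ρ k n = ⊥ := by
  have : {T : Cell cs n | k ≤ N ∧ ∀ t : Fin N, (N : ℤ) ≤ (t : ℤ) + k → t ∈ T.1} = ∅ := by
    refine Set.eq_empty_of_forall_notMem fun T ⟨hkN, hT⟩ => ?_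
    have hcard := T.2.1
    obtain ⟨m, rfl⟩ : ∃ m : ℕ, k = m := ⟨k.toNat, by lia⟩
    have hm : m ≤ N := by exact_mod_cast hkN
    -- The last `m = k` vertices, all forced into `T`; hence `k ≤ |T| = n`.
    let f : Fin m → Fin N := fun a => ⟨N - m + a, by lia⟩
    have hf : Function.Injective f := fun a b hab => by
      have := congrArg Fin.val hab
      simp only [f] at this
      exact Fin.ext (by lia)
    have hle : (Finset.univ.image f).card ≤ T.1.card := Finset.card_le_card fun t ht => by
      obtain ⟨a, -, rfl⟩ := Finset.mem_image.1 ht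
      refine hT _ ?_
      simp only [f]
      lia
    rw [Finset.card_image_of_injective _ hf, Finset.card_univ, Fintype.card_fin] at hle
    lia
  rw [filtration, this, Finsupp.supported_empty]

theorem complex_d_mem_filtration (hδ : ∀ n, delta cs ρ (n + 1) ∘ₗ delta cs ρ n = 0) (k n m : ℤ)
    {x : Cochain cs ρ n} (hx : x ∈ filtration cs ρ k n) :
    ((complex cs ρ hδ).d n m).hom x ∈ filtration cs ρ k m := by
  by_cases h : n + 1 = m
  · subst h
    have : (complex cs ρ hδ).d n (n + 1) = ModuleCat.ofHom (delta cs ρ n) :=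
      CochainComplex.of_d (fun n => ModuleCat.of R (Cochain cs ρ n))
        (fun n => ModuleCat.ofHom (delta cs ρ n)) n
    rw [this]
    exact delta_mem_filtration cs ρ hx
  · rw [(complex cs ρ hδ).shape n m h]
    exact zero_mem _

/-- The filtration of the algebraic Salvetti complex by subcomplexes. -/
noncomputable def complexFiltration (hδ : ∀ n, delta cs ρ (n + 1) ∘ₗ delta cs ρ n = 0) :
    ComplexFiltration (complex cs ρ hδ) where
  F k n := filtration cs ρ k n
  anti n _ _ h := filtration_anti cs ρ h n
  d_mem k n m _ hx := complex_d_mem_filtration cs ρ hδ k n m hx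

end Salvetti

/-! ### The spectral sequence of the algebraic Salvetti complex. -/

theorem theoremt {N : ℕ} (Γ : CoxeterMatrix (Fin N)) {W : Type u} [Group W]
    (cs : CoxeterSystem Γ W) {M : Type v} [AddCommGroup M]
    (ρ : ArtinGroup Γ →* (M ≃ₗ[ℤ] M)) :
    -- the pair `(C^*, δ)` is a cochain complex
    ∃ hδ : ∀ n, Salvetti.delta cs ρ (n + 1) ∘ₗ Salvetti.delta cs ρ n = 0,
    -- the submodules `F^k C^n` form a decreasing filtration by subcomplexes
    ∃ 𝓕 : ComplexFiltration (Salvetti.complex cs ρ hδ),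
      (∀ k n, 𝓕.F k n = Salvetti.filtration cs ρ k n) ∧
      (∀ k n, k ≤ 0 → 𝓕.F k n = ⊤) ∧
      (∀ k n, (N : ℤ) + 1 ≤ k → 𝓕.F k n = ⊥) ∧
    -- its spectral sequence
    ∃ S : 𝓕.AssociatedSpectralSequence,
      S.IsFirstQuadrant ∧
      -- the page `E_0` with its differential
      ∃ e₀ : ∀ i j : ℤ, (S.E.page 0).X (i, j) ≅ (𝓕.quot i (i + 1)).X (i + j),
        (∀ (i j : ℤ) (x : 𝓕.Z 0 i (i + j)),
          (e₀ i j).hom.hom (S.cls 0 le_rfl i j x) = 𝓕.toQuot i (i + 1) (i + j) ⟨x.1, x.2.1⟩) ∧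
        (∀ i j : ℤ, (S.E.page 0).d (i, j) (i, j + 1) ≫ (e₀ i (j + 1)).hom =
          (e₀ i j).hom ≫ (𝓕.quot i (i + 1)).d (i + j) (i + (j + 1))) ∧
      -- the page `E_1`, the isomorphism `e₁` being induced by `e₀`, with its differential
      ∃ e₁ : ∀ i j : ℤ, (S.E.page 1).X (i, j) ≅ (𝓕.quot i (i + 1)).homology (i + j),
        (∀ (i j : ℤ) (z : (S.E.page 0).cycles (i, j)) (y : (𝓕.quot i (i + 1)).cycles (i + j)),
          ((𝓕.quot i (i + 1)).iCycles (i + j)).hom y =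
            (e₀ i j).hom.hom (((S.E.page 0).iCycles (i, j)).hom z) →
          (e₁ i j).hom.hom
              ((S.E.iso 0 1 (i, j)).hom.hom (((S.E.page 0).homologyπ (i, j)).hom z)) =
            ((𝓕.quot i (i + 1)).homologyπ (i + j)).hom y) ∧
        (∀ i : ℤ, ∃ hS : (𝓕.triple i).ShortExact, ∀ j : ℤ,
          (S.E.page 1).d (i, j) (i + 1, j) ≫ (e₁ (i + 1) j).hom =
            (e₁ i j).hom ≫
              hS.δ (i + j) (i + 1 + j) (show i + j + 1 = i + 1 + j by ring)) ∧
      -- convergence to the cohomology of `(C^*, δ)`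
      (∀ n : ℤ, 𝓕.onCohomology 0 n = ⊤ ∧ 𝓕.onCohomology (n + 1) n = ⊥) ∧
      S.Converges := by
  have hδ := Salvetti.delta_comp_delta cs ρ
  let 𝓕 := Salvetti.complexFiltration cs ρ hδ
  have htop : ∀ k n, k ≤ 0 → 𝓕.F k n = ⊤ := fun k n hk => Salvetti.filtration_eq_top cs ρ hk n
  have hbot : ∀ k n, (N : ℤ) + 1 ≤ k → 𝓕.F k n = ⊥ := fun k n hk =>
    Salvetti.filtration_eq_bot cs ρ hk n
  have hlt : ∀ k n, n < k → 𝓕.F k n = ⊥ := fun k n hk => Salvetti.filtration_eq_bot_of_lt cs ρ hk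
  let S := 𝓕.associatedSpectralSequence
  refine ⟨hδ, 𝓕, fun _ _ => rfl, htop, hbot, S, ?_, S.pageZeroIso, S.pageZeroIso_cls,
    S.pageZeroIso_d, S.pageOneIso, S.pageOneIso_iso_homologyπ,
    fun i => ⟨𝓕.triple_shortExact i, S.pageOneIso_d i⟩,
    fun n => ⟨𝓕.onCohomology_eq_top (htop 0 n le_rfl),
      𝓕.onCohomology_eq_bot (hlt (n + 1) n (by lia))⟩,
    S.converges_of_bounded htop hbot⟩
  -- For `i < 0` the filtration is constant from `i` to `i + 1`. For `j < 0` the total degree `i +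
  -- j` is below `i`, so `F^i` is already zero there.
  rintro r hr i j (hi | hj)
  · exact S.isZero_of_F_le hr (by rw [htop (i + 1) _ (by lia)]; exact le_top)
  · exact S.isZero_of_F_le hr (by rw [hlt i _ (by lia)]; exact bot_le)
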